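/- An instance of a self-contained $k$-witness problem consists of a universe $U$ of $n$ elements, a parameter $k$ and further input data; its witnesses are the $k$-element subsets of $U$ that have a property specified by the instance. Let $N$ be the number of witnesses. The decision oracle $\mathrm{ORA}$ answers, for a given $X\subseteq U$, whether some witness is contained in $X$. Algorithms are programs for a random access machine with fair coin tosses (natural-number registers, unit-cost steps, no multiplication, so that the bit length of numbers grows by $O(1)$ per step); handing over a subset of $U$ (to the oracle, to a subroutine or to the output) takes $n+1$ steps. There are a randomised oracle algorithm $P$ and a constant $c$, independent of the problem, such that the following hold. (1) For every self-contained $k$-witness problem and every instance of it, $P$, given access to the deterministic oracle $\mathrm{ORA}$, halts and outputs every witness exactly once and nothing else, whatever the outcome of its coin tosses, and the expected number of oracle calls is at most $$1+2^{ck}\,(\log_2 n)^2\, N$$ (where $\log_2 0$ is read as $0$). That is, it is $2^{O(k)}\log^2 n\cdot N$ whenever $N\ge 1$ and $n\ge 2$. (2) Suppose that, for some function $g:\mathbb N\to\mathbb N$ and some $d\in\mathbb{N}$, a deterministic procedure $D$ executes each oracle call of the problem, on every instance, in at most $g(k)\,(n+1)^{d}$ steps. Then $P$, with its oracle calls replaced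 by calls of $D$, still halts and outputs every witness exactly once and nothing else for all outcomes of the coin tosses, and its expected total running time, including the time spent in $D$, is at most $$2^{c(k+1)}\cdot g(k)\cdot (n+1)^{d+c}\cdot \max(N,1),$$ that is, $2^{O(k)}\, g(k)\, n^{O(1)} N$ whenever $n,k,N\geq 1$. (3) Consequently, if the decision problem (given an instance and $X\subseteq U$, is there a witness contained in $X$?) is in FPT, i.e. solvable by a deterministic algorithm in time $g(k)\, s^{O(1)}$ with $g$ computable and $s$ the total input size, then the enumeration problem has an expected-output-fpt algorithm: a randomised algorithm that always outputs every witness exactly once and nothing else, and whose expected running time is at most $f(k)\,(s+N)^{O(1)}$ for some computable $f$. -/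

import Mathlib

namespace WitnessEnum

open scoped ENNReal

/-! ### Self-contained `k`-witness problems -/

/-- An instance: the universe is `U = {0, …, n-1}`, the parameter is `k`, and `data` is the rest of
the input (for instance the adjacency matrix of a graph), written as a bit string. -/
structure Instance where
  n : ℕ
  k : ℕ
  data : List Bool

/-- The total input size: the elements of the universe together with the bits of `data`. -/
def Instance.size (I : Instance) : ℕ := I.n + I.data.length

/-- A self-contained `k`-witness problem: a set of instances and, for each instance, a property of
subsets of the universe. The `k`-subsets of the universe with this property are the witnesses. -/
structure Problem where
  instances : Set Instance
  prop : Instance → Finset ℕ → Prop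

open Classical in
/-- The set of witnesses of an instance. -/
noncomputable def Problem.witnesses (Q : Problem) (I : Instance) : Finset (Finset ℕ) :=
  ((Finset.range I.n).powersetCard I.k).filter (Q.prop I)

/-- The decision oracle: on `X ⊆ U`, is some witness entirely contained in `X`? -/
def ora (𝒲 : Finset (Finset ℕ)) (X : Finset ℕ) : Bool := decide (∃ W ∈ 𝒲, W ⊆ X)

/-! ### The machine model

A randomised random access machine in structured form. Registers and array cells hold natural
numbers. The universe size `n`, the parameter `k` and the bit string `data` are read-only. Every
assignment, store, test and coin toss costs one step; there is no multiplication, so the bit length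
of the numbers grows by at most a constant in each step. An operation that hands over a subset of the
universe (oracle call, procedure call, output) costs `n + 1` steps, and a procedure call costs in
addition all the steps of the procedure. -/

/-- Expressions. -/
inductive Term where
  | lit (m : ℕ)
  | reg (i : ℕ)
  | cell (a : ℕ) (e : Term)
  | univ
  | param
  | dataLen
  | dataBit (e : Term)
  | add (e₁ e₂ : Term)
  | sub (e₁ e₂ : Term)
  | div (e₁ e₂ : Term)
  | mod (e₁ e₂ : Term)
  | lt (e₁ e₂ : Term)
  | eq (e₁ e₂ : Term)

/-- Programs. A subset `X` of the universe is stored in an array `a` through `X = {i < n | a[i] ≠ 0}`.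
* `flip i` puts a fair random bit into register `i`;
* `emit a` outputs the subset stored in `a`;
* `query a i` asks the oracle about the subset stored in `a`, and puts the answer into register `i`;
* `call D a i` runs `D`, in a fresh memory of its own, on the subset stored in `a`, and puts the
  truth value of register `0` of `D` at the end into register `i`. -/
inductive Prog where
  | set (i : ℕ) (e : Term)
  | store (a : ℕ) (e₁ e₂ : Term)
  | seq (s₁ s₂ : Prog)
  | cond (b : Term) (s₁ s₂ : Prog)
  | loop (b : Term) (s : Prog)
  | flip (i : ℕ)
  | emit (a : ℕ)
  | query (a i : ℕ)
  | call (D : Prog) (a i : ℕ)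

/-- `P.link D`: each oracle call of `P` is replaced by a call of the procedure `D`. -/
def Prog.link : Prog → Prog → Prog
  | .set i e, _ => .set i e
  | .store a e₁ e₂, _ => .store a e₁ e₂
  | .seq s₁ s₂, D => .seq (s₁.link D) (s₂.link D)
  | .cond b s₁ s₂, D => .cond b (s₁.link D) (s₂.link D)
  | .loop b s, D => .loop b (s.link D)
  | .flip i, _ => .flip i
  | .emit a, _ => .emit a
  | .query a i, D => .call D a i
  | .call E a i, D => .call (E.link D) a i

/-- The memory, the list of outputs, the number of steps and of oracle calls so far. Programs cannot
read the last three. -/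
@[ext] structure State where
  reg : ℕ → ℕ
  arr : ℕ → ℕ → ℕ
  out : List (Finset ℕ)
  time : ℕ
  calls : ℕ

namespace State

/-- Empty memory. -/
def init : State := ⟨fun _ => 0, fun _ _ => 0, [], 0, 0⟩

/-- Start of a procedure with argument `X`: array `0` holds the indicator function of `X`. -/
def start (X : Finset ℕ) : State :=
  { init with arr := fun a i => if a = 0 ∧ i ∈ X then 1 else 0 }

/-- Let `t` steps pass. -/
def tick (σ : State) (t : ℕ) : State := { σ with time := σ.time + t }

def setReg (σ : State) (i v : ℕ) : State := { σ with reg := Function.update σ.reg i v }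

def setCell (σ : State) (a j v : ℕ) : State :=
  { σ with arr := Function.update σ.arr a (Function.update (σ.arr a) j v) }

/-- The subset of the universe stored in the array `a`. -/
def subset (σ : State) (n a : ℕ) : Finset ℕ := (Finset.range n).filter (fun i => σ.arr a i ≠ 0)

end State

/-- Value of an expression. -/
def Term.eval (I : Instance) (σ : State) : Term → ℕ
  | .lit m => m
  | .reg i => σ.reg i
  | .cell a e => σ.arr a (e.eval I σ)
  | .univ => I.n
  | .param => I.k
  | .dataLen => I.data.length
  | .dataBit e => (I.data.getD (e.eval I σ) false).toNat
  | .add e₁ e₂ => e₁.eval I σ + e₂.eval I σ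
  | .sub e₁ e₂ => e₁.eval I σ - e₂.eval I σ
  | .div e₁ e₂ => e₁.eval I σ / e₂.eval I σ
  | .mod e₁ e₂ => e₁.eval I σ % e₂.eval I σ
  | .lt e₁ e₂ => if e₁.eval I σ < e₂.eval I σ then 1 else 0
  | .eq e₁ e₂ => if e₁.eval I σ = e₂.eval I σ then 1 else 0

/-- `Exec I O s σ μ`: on the instance `I`, with oracle `O` (`none` if there is no oracle, and then an
oracle call never returns), the program `s` started in `σ` halts for every outcome of the coin
tosses, and `μ` is the distribution of the final state. -/
inductive Exec (I : Instance) (O : Option (Finset ℕ → Bool)) : Prog → State → PMF State → Prop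
  | set (i : ℕ) (e : Term) (σ : State) :
      Exec I O (.set i e) σ (PMF.pure ((σ.setReg i (e.eval I σ)).tick 1))
  | store (a : ℕ) (e₁ e₂ : Term) (σ : State) :
      Exec I O (.store a e₁ e₂) σ (PMF.pure ((σ.setCell a (e₁.eval I σ) (e₂.eval I σ)).tick 1))
  | seq {s₁ s₂ : Prog} {σ : State} {μ : PMF State} {κ : State → PMF State} :
      Exec I O s₁ σ μ → (∀ τ ∈ μ.support, Exec I O s₂ τ (κ τ)) →
      Exec I O (.seq s₁ s₂) σ (μ.bind κ)
  | condTrue {b : Term} {s₁ s₂ : Prog} {σ : State} {μ : PMF State} :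
      b.eval I σ ≠ 0 → Exec I O s₁ (σ.tick 1) μ → Exec I O (.cond b s₁ s₂) σ μ
  | condFalse {b : Term} {s₁ s₂ : Prog} {σ : State} {μ : PMF State} :
      b.eval I σ = 0 → Exec I O s₂ (σ.tick 1) μ → Exec I O (.cond b s₁ s₂) σ μ
  | loopStop {b : Term} {s : Prog} {σ : State} :
      b.eval I σ = 0 → Exec I O (.loop b s) σ (PMF.pure (σ.tick 1))
  | loopStep {b : Term} {s : Prog} {σ : State} {μ : PMF State} {κ : State → PMF State} :
      b.eval I σ ≠ 0 → Exec I O s (σ.tick 1) μ →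
      (∀ τ ∈ μ.support, Exec I O (.loop b s) τ (κ τ)) →
      Exec I O (.loop b s) σ (μ.bind κ)
  | flip (i : ℕ) (σ : State) :
      Exec I O (.flip i) σ
        ((PMF.uniformOfFintype Bool).map fun c => (σ.setReg i c.toNat).tick 1)
  | emit (a : ℕ) (σ : State) :
      Exec I O (.emit a) σ
        (PMF.pure ({ σ with out := σ.out ++ [σ.subset I.n a] }.tick (I.n + 1)))
  | query {f : Finset ℕ → Bool} (a i : ℕ) (σ : State) :
      O = some f →
      Exec I O (.query a i) σ
        (PMF.pure ({ σ.setReg i (f (σ.subset I.n a)).toNat with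
          calls := σ.calls + 1 }.tick (I.n + 1)))
  | call {D : Prog} {σ : State} {μ : PMF State} (a i : ℕ) :
      Exec I O D (State.start (σ.subset I.n a)) μ →
      Exec I O (.call D a i) σ
        (μ.map fun τ => { σ.setReg i (if τ.reg 0 = 0 then 0 else 1) with
          calls := σ.calls + τ.calls }.tick (I.n + 1 + τ.time))

/-- The distribution of the final state is determined by the program and the initial state. -/
theorem Exec.unique {I : Instance} {O : Option (Finset ℕ → Bool)} {s : Prog} {σ : State}
    {μ ν : PMF State} (h : Exec I O s σ μ) (h' : Exec I O s σ ν) : μ = ν := by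
  have key : ∀ (μ : PMF State) (κ κ' : State → PMF State),
      (∀ τ ∈ μ.support, κ τ = κ' τ) → μ.bind κ = μ.bind κ' := by
    intro μ κ κ' hk
    ext x
    simp only [PMF.bind_apply]
    refine tsum_congr fun τ => ?_
    by_cases hτ : τ ∈ μ.support
    · rw [hk τ hτ]
    · rw [(PMF.apply_eq_zero_iff μ τ).2 hτ]; simp
  induction h generalizing ν with
  | set i e σ => cases h'; rfl
  | store a e₁ e₂ σ => cases h'; rfl
  | seq _ _ ih₁ ih₂ =>
    cases h' with
    | seq h₁ h₂ =>
      obtain rfl := ih₁ h₁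
      exact key _ _ _ fun τ hτ => ih₂ τ hτ (h₂ τ hτ)
  | condTrue hb _ ih =>
    cases h' with
    | condTrue _ h => exact ih h
    | condFalse hb' _ => exact absurd hb' hb
  | condFalse hb _ ih =>
    cases h' with
    | condTrue hb' _ => exact absurd hb hb'
    | condFalse _ h => exact ih h
  | loopStop hb =>
    cases h' with
    | loopStop _ => rfl
    | loopStep hb' _ _ => exact absurd hb hb'
  | loopStep hb _ _ ih₁ ih₂ =>
    cases h' with
    | loopStop hb' => exact absurd hb' hb
    | loopStep _ h₁ h₂ =>
      obtain rfl := ih₁ h₁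
      exact key _ _ _ fun τ hτ => ih₂ τ hτ (h₂ τ hτ)
  | flip i σ => cases h'; rfl
  | emit a σ => cases h'; rfl
  | query a i σ hO =>
    cases h' with
    | query _ _ _ hO' =>
      rw [hO] at hO'
      cases hO'
      rfl
  | call a i _ ih =>
    cases h' with
    | call _ _ h => rw [ih h]

/-- The expectation of a cost measure. -/
noncomputable def expect (μ : PMF State) (f : State → ℕ) : ℝ≥0∞ := ∑' τ, μ τ * (f τ : ℝ≥0∞)

/-- `Enumerates I O P 𝒲 μ`: the run of `P` has outcome distribution `μ`, and in every outcome the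
list of outputs contains each member of `𝒲` exactly once and nothing else. -/
def Enumerates (I : Instance) (O : Option (Finset ℕ → Bool)) (P : Prog) (𝒲 : Finset (Finset ℕ))
    (μ : PMF State) : Prop :=
  Exec I O P State.init μ ∧ ∀ τ ∈ μ.support, τ.out.Nodup ∧ τ.out.toFinset = 𝒲

/-- `D`, without any oracle, executes the call of the decision oracle on `X` within `t` steps.
The outcome does not depend on coin tosses. -/
def DecidesWithin (I : Instance) (𝒲 : Finset (Finset ℕ)) (D : Prog) (X : Finset ℕ) (t : ℕ) : Prop :=
  ∃ τ, Exec I none D (State.start X) (PMF.pure τ) ∧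
    (τ.reg 0 ≠ 0 ↔ ora 𝒲 X = true) ∧ τ.time ≤ t

/-- The decision version (given an instance and `X ⊆ U`, does `X` contain a witness?) belongs to FPT. -/
def Problem.DecisionFPT (Q : Problem) : Prop :=
  ∃ (D : Prog) (g : ℕ → ℕ) (d : ℕ), Computable g ∧
    ∀ I ∈ Q.instances, ∀ X ⊆ Finset.range I.n,
      DecidesWithin I (Q.witnesses I) D X (g I.k * (I.size + 1) ^ d)

/-- There is an expected-output-fpt algorithm for the enumeration problem: it enumerates all the
witnesses in expected time `f(k) · (size + N)^{O(1)}` with `f` computable. -/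
def Problem.ExpectedOutputFPT (Q : Problem) : Prop :=
  ∃ (E : Prog) (f : ℕ → ℕ) (e : ℕ), Computable f ∧
    ∀ I ∈ Q.instances, ∃ μ, Enumerates I none E (Q.witnesses I) μ ∧
      expect μ State.time ≤ ((f I.k * (I.size + (Q.witnesses I).card + 1) ^ e : ℕ) : ℝ≥0∞)

end WitnessEnum

open WitnessEnum

namespace WitnessEnum

/-! ### Runs of programs -/

namespace State

/-! The algorithm derandomises correctness and randomises only cost. Put b = `width n` and T =
(k+3)b. Each element u receives a T-bit key: (k+2)b random bits followed by the b bits of u. Keys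
are therefore always distinct, and a witness is the same thing as an increasing k-tuple of keys that
the oracle accepts. These tuples are the leaves of a tree of degree 2^k. A node of height h is a
k-tuple of rows, that is of keys truncated by h bits, coded as one number by interleaving their
digits. A node is live if its rows are nondecreasing, each is matched by an element, and the oracle
accepts the set of matching elements. Since the oracle is monotone, ancestors of live nodes are live
(`Live.parent`), so nothing is lost below a node that fails, and the live leaves yield each witness
exactly once (`leafSets_spec`).

The traversal restarts from the root for every descent, which costs at most T+1 oracle calls. Each
descent ends at a new node that is the root or has a live parent (`tri_explore_loop`), so the number
of descents is at most 1 + 2^k times the number of live nodes (`card_frontier_le`).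

It remains to show that every height has on average at most 8^k N live nodes. Where only random bits
survive truncation (`sum_card_liveNodes_le`), let D be the number of possible truncated keys. A live
node contains some witness among its matching elements. A fixed witness falls into a fixed tuple
with probability at most (min(k,D)/D)^k, and there are C(D+k-1,k) nondecreasing tuples;
`choose_mul_min_pow_le` bounds the product by 8^k. Where all random bits survive, truncated keys are
distinct unless two random parts collide. If they are distinct, the candidates of a live node are
themselves a witness that determines the node. If not, there are at most n^k live nodes, but the
probability is at most n^2/2^((k+2)b) ≤ n^(-k) for n ≥ 1.

Summing over T heights and multiplying by T+1 calls gives 2^{O(k)} log² n · N. The running time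
follows from the same count, since the program is analysed once for any implementation of the oracle
call (`AskSpec`). -/

@[simp] theorem tick_reg (σ : State) (t : ℕ) : (σ.tick t).reg = σ.reg := rfl
@[simp] theorem tick_arr (σ : State) (t : ℕ) : (σ.tick t).arr = σ.arr := rfl
@[simp] theorem tick_out (σ : State) (t : ℕ) : (σ.tick t).out = σ.out := rfl
@[simp] theorem tick_calls (σ : State) (t : ℕ) : (σ.tick t).calls = σ.calls := rfl
@[simp] theorem tick_time (σ : State) (t : ℕ) : (σ.tick t).time = σ.time + t := rfl
@[simp] theorem setReg_reg (σ : State) (i v j : ℕ) :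
    (σ.setReg i v).reg j = if j = i then v else σ.reg j := by
  simp [setReg, Function.update_apply]
@[simp] theorem setReg_arr (σ : State) (i v : ℕ) : (σ.setReg i v).arr = σ.arr := rfl
@[simp] theorem setReg_out (σ : State) (i v : ℕ) : (σ.setReg i v).out = σ.out := rfl
@[simp] theorem setReg_calls (σ : State) (i v : ℕ) : (σ.setReg i v).calls = σ.calls := rfl
@[simp] theorem setReg_time (σ : State) (i v : ℕ) : (σ.setReg i v).time = σ.time := rfl
@[simp] theorem setCell_reg (σ : State) (a i v : ℕ) : (σ.setCell a i v).reg = σ.reg := rfl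
@[simp] theorem setCell_arr (σ : State) (a i v a' i' : ℕ) :
    (σ.setCell a i v).arr a' i' = if a' = a ∧ i' = i then v else σ.arr a' i' := by
  by_cases h : a' = a
  · subst h; simp [setCell, Function.update_apply]
  · simp [setCell, h]
@[simp] theorem setCell_out (σ : State) (a i v : ℕ) : (σ.setCell a i v).out = σ.out := rfl
@[simp] theorem setCell_calls (σ : State) (a i v : ℕ) : (σ.setCell a i v).calls = σ.calls := rfl
@[simp] theorem setCell_time (σ : State) (a i v : ℕ) : (σ.setCell a i v).time = σ.time := rfl

end State

variable {I : Instance} {O : Option (Finset ℕ → Bool)}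

/-- Sequential composition, with the intermediate distribution given as an image. -/
theorem Exec.seq_map {Ω : Type} {s₁ s₂ : Prog} {σ : State} {ν : PMF Ω} {F : Ω → State}
    {κ : Ω → PMF State} (h₁ : Exec I O s₁ σ (ν.map F)) (h₂ : ∀ ω, Exec I O s₂ (F ω) (κ ω)) :
    Exec I O (.seq s₁ s₂) σ (ν.bind κ) := by
  classical
  -- `Exec.seq` needs a kernel on states, whereas `κ` is indexed by `Ω` and `F` need not be
  -- injective. Any chosen run from `F ω` will do, because `Exec.unique` identifies it with `κ ω`.
  let κ' : State → PMF State := fun τ =>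
    if h : ∃ μ, Exec I O s₂ τ μ then h.choose else PMF.pure τ
  have hκ : ∀ ω, Exec I O s₂ (F ω) (κ' (F ω)) := fun ω => by
    have h : ∃ μ, Exec I O s₂ (F ω) μ := ⟨_, h₂ ω⟩
    simp only [κ', dif_pos h]
    exact h.choose_spec
  have hb : ν.bind κ = (ν.map F).bind κ' := by
    rw [PMF.bind_map]
    congr 1
    funext ω
    exact (h₂ ω).unique (hκ ω)
  rw [hb]
  refine .seq h₁ fun τ hτ => ?_
  obtain ⟨ω, -, rfl⟩ := (PMF.mem_support_map_iff F ν τ).1 hτ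
  exact hκ ω

/-- A step of a loop, with the intermediate distribution given as an image. -/
theorem Exec.loop_map {Ω : Type} {b : Term} {s : Prog} {σ : State} {ν : PMF Ω} {F : Ω → State}
    {κ : Ω → PMF State} (hb : b.eval I σ ≠ 0) (h₁ : Exec I O s (σ.tick 1) (ν.map F))
    (h₂ : ∀ ω, Exec I O (.loop b s) (F ω) (κ ω)) :
    Exec I O (.loop b s) σ (ν.bind κ) := by
  classical
  let κ' : State → PMF State := fun τ =>
    if h : ∃ μ, Exec I O (.loop b s) τ μ then h.choose else PMF.pure τ
  have hκ : ∀ ω, Exec I O (.loop b s) (F ω) (κ' (F ω)) := fun ω => by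
    have h : ∃ μ, Exec I O (.loop b s) (F ω) μ := ⟨_, h₂ ω⟩
    simp only [κ', dif_pos h]
    exact h.choose_spec
  have hb : ν.bind κ = (ν.map F).bind κ' := by
    rw [PMF.bind_map]
    congr 1
    funext ω
    exact (h₂ ω).unique (hκ ω)
  rw [hb]
  refine .loopStep ‹_› h₁ fun τ hτ => ?_
  obtain ⟨ω, -, rfl⟩ := (PMF.mem_support_map_iff F ν τ).1 hτ
  exact hκ ω

/-- Every program takes at least one step. -/
theorem Exec.time_lt {s : Prog} {σ : State} {μ : PMF State} (h : Exec I O s σ μ) :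
    ∀ τ ∈ μ.support, σ.time < τ.time := by
  induction h with
  | set | store | loopStop | emit | query => simp
  | seq _ _ ih₁ ih₂ =>
    intro τ hτ
    obtain ⟨ρ, hρ, hτ⟩ := (PMF.mem_support_bind_iff _ _ _).1 hτ
    exact (ih₁ ρ hρ).trans (ih₂ ρ hρ τ hτ)
  | condTrue _ _ ih | condFalse _ _ ih =>
    intro τ hτ
    exact (Nat.lt_succ_self _).trans (ih τ hτ)
  | loopStep _ _ _ ih₁ ih₂ =>
    intro τ hτ
    obtain ⟨ρ, hρ, hτ⟩ := (PMF.mem_support_bind_iff _ _ _).1 hτ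
    exact (Nat.lt_succ_self _).trans ((ih₁ ρ hρ).trans (ih₂ ρ hρ τ hτ))
  | flip i σ =>
    intro τ hτ
    obtain ⟨c, -, rfl⟩ := (PMF.mem_support_map_iff _ _ _).1 hτ
    simp
  | call a i _ _ =>
    intro τ hτ
    obtain ⟨c, -, rfl⟩ := (PMF.mem_support_map_iff _ _ _).1 hτ
    simp

/-- Without an oracle there are no oracle calls. -/
theorem Exec.calls_eq {s : Prog} {σ : State} {μ : PMF State} (h : Exec I none s σ μ) :
    ∀ τ ∈ μ.support, τ.calls = σ.calls := by
  generalize hO : (none : Option (Finset ℕ → Bool)) = O at h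
  induction h with
  | set | store | loopStop | emit => simp
  | query _ _ _ hf => simp [← hO] at hf
  | seq _ _ ih₁ ih₂ | loopStep _ _ _ ih₁ ih₂ =>
    intro τ hτ
    obtain ⟨ρ, hρ, hτ⟩ := (PMF.mem_support_bind_iff _ _ _).1 hτ
    exact (ih₂ ρ hρ τ hτ).trans (ih₁ ρ hρ)
  | condTrue _ _ ih | condFalse _ _ ih => exact ih
  | flip i σ =>
    intro τ hτ
    obtain ⟨c, -, rfl⟩ := (PMF.mem_support_map_iff _ _ _).1 hτ
    simp
  | call a i _ ih =>
    intro τ hτ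
    obtain ⟨c, hc, rfl⟩ := (PMF.mem_support_map_iff _ _ _).1 hτ
    have := ih c hc
    simp [State.start, State.init] at this
    simp [this]

/-! ### The part of the state that a program leaves alone -/

/-- The registers that a program may change. -/
def Prog.regs : Prog → List ℕ
  | .set i _ => [i]
  | .store _ _ _ => []
  | .seq s₁ s₂ => s₁.regs ++ s₂.regs
  | .cond _ s₁ s₂ => s₁.regs ++ s₂.regs
  | .loop _ s => s.regs
  | .flip i => [i]
  | .emit _ => []
  | .query _ i => [i]
  | .call _ _ i => [i]

/-- The arrays that a program may change. -/
def Prog.arrs : Prog → List ℕ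
  | .store a _ _ => [a]
  | .seq s₁ s₂ => s₁.arrs ++ s₂.arrs
  | .cond _ s₁ s₂ => s₁.arrs ++ s₂.arrs
  | .loop _ s => s.arrs
  | _ => []

/-- The program contains an output instruction. -/
def Prog.emits : Prog → Bool
  | .seq s₁ s₂ => s₁.emits || s₂.emits
  | .cond _ s₁ s₂ => s₁.emits || s₂.emits
  | .loop _ s => s.emits
  | .emit _ => true
  | _ => false

/-- The program contains an oracle call or a procedure call. -/
def Prog.asks : Prog → Bool
  | .seq s₁ s₂ => s₁.asks || s₂.asks
  | .cond _ s₁ s₂ => s₁.asks || s₂.asks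
  | .loop _ s => s.asks
  | .query _ _ => true
  | .call _ _ _ => true
  | _ => false

/-- `τ` agrees with `σ` on everything that `s` cannot change. -/
structure Frame (s : Prog) (σ τ : State) : Prop where
  reg : ∀ r ∉ s.regs, τ.reg r = σ.reg r
  arr : ∀ a ∉ s.arrs, τ.arr a = σ.arr a
  out : s.emits = false → τ.out = σ.out
  calls : s.asks = false → τ.calls = σ.calls

theorem Frame.refl (s : Prog) (σ : State) : Frame s σ σ :=
  ⟨fun _ _ => rfl, fun _ _ => rfl, fun _ => rfl, fun _ => rfl⟩

theorem Frame.trans {s : Prog} {σ τ ρ : State} (h₁ : Frame s σ τ) (h₂ : Frame s τ ρ) :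
    Frame s σ ρ :=
  ⟨fun r hr => (h₂.reg r hr).trans (h₁.reg r hr), fun a ha => (h₂.arr a ha).trans (h₁.arr a ha),
    fun h => (h₂.out h).trans (h₁.out h), fun h => (h₂.calls h).trans (h₁.calls h)⟩

theorem Frame.tick_left {s : Prog} {σ τ : State} {t : ℕ} (h : Frame s (σ.tick t) τ) : Frame s σ τ :=
  ⟨h.reg, h.arr, h.out, h.calls⟩

theorem Frame.tick_right {s : Prog} {σ τ : State} {t : ℕ} (h : Frame s σ τ) :
    Frame s σ (τ.tick t) :=
  ⟨h.reg, h.arr, h.out, h.calls⟩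

theorem Frame.mono {s s' : Prog} {σ τ : State} (h : Frame s σ τ) (hr : s.regs ⊆ s'.regs)
    (ha : s.arrs ⊆ s'.arrs) (he : s'.emits = false → s.emits = false)
    (hc : s'.asks = false → s.asks = false) : Frame s' σ τ :=
  ⟨fun r h' => h.reg r fun h'' => h' (hr h''), fun a h' => h.arr a fun h'' => h' (ha h''),
    fun h' => h.out (he h'), fun h' => h.calls (hc h')⟩

theorem Frame.seq_left {s₁ s₂ : Prog} {σ τ : State} (h : Frame s₁ σ τ) :
    Frame (.seq s₁ s₂) σ τ :=
  h.mono (List.subset_append_left _ _) (List.subset_append_left _ _) (by simp +contextual [Prog.emits])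
    (by simp +contextual [Prog.asks])

theorem Frame.seq_right {s₁ s₂ : Prog} {σ τ : State} (h : Frame s₂ σ τ) :
    Frame (.seq s₁ s₂) σ τ :=
  h.mono (List.subset_append_right _ _) (List.subset_append_right _ _) (by simp [Prog.emits])
    (by simp [Prog.asks])

/-- The changeable registers and arrays are computed from the program text, so for concrete programs
the preservation of everything else is settled by `decide`. -/
theorem Exec.frame {s : Prog} {σ : State} {μ : PMF State} (h : Exec I O s σ μ) :
    ∀ τ ∈ μ.support, Frame s σ τ := by
  induction h with
  | set i e σ =>
    intro τ hτ
    obtain rfl : τ = _ := by simpa using hτ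
    constructor <;> simp +contextual [Prog.regs]
  | store a e₁ e₂ σ =>
    intro τ hτ
    obtain rfl : τ = _ := by simpa using hτ
    constructor <;> simp +contextual [Prog.regs, Prog.arrs, State.setCell]
  | seq _ _ ih₁ ih₂ =>
    intro τ hτ
    obtain ⟨ρ, hρ, hτ⟩ := (PMF.mem_support_bind_iff _ _ _).1 hτ
    exact (ih₁ ρ hρ).seq_left.trans (ih₂ ρ hρ τ hτ).seq_right
  | condTrue _ _ ih =>
    exact fun τ hτ => (ih τ hτ).tick_left.mono (List.subset_append_left _ _)
      (List.subset_append_left _ _) (by simp +contextual [Prog.emits])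
      (by simp +contextual [Prog.asks])
  | condFalse _ _ ih =>
    exact fun τ hτ => (ih τ hτ).tick_left.mono (List.subset_append_right _ _)
      (List.subset_append_right _ _) (by simp +contextual [Prog.emits])
      (by simp +contextual [Prog.asks])
  | loopStop _ =>
    intro τ hτ
    obtain rfl : τ = _ := by simpa using hτ
    exact (Frame.refl _ _).tick_right
  | loopStep _ _ _ ih₁ ih₂ =>
    intro τ hτ
    obtain ⟨ρ, hρ, hτ⟩ := (PMF.mem_support_bind_iff _ _ _).1 hτ
    exact ((ih₁ ρ hρ).tick_left.mono (s' := .loop _ _) (List.Subset.refl _) (List.Subset.refl _)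
      id id).trans (ih₂ ρ hρ τ hτ)
  | flip i σ =>
    intro τ hτ
    obtain ⟨c, -, rfl⟩ := (PMF.mem_support_map_iff _ _ _).1 hτ
    constructor <;> simp +contextual [Prog.regs]
  | emit a σ =>
    intro τ hτ
    obtain rfl : τ = _ := by simpa using hτ
    constructor <;> simp +contextual [Prog.emits]
  | query a i σ _ =>
    intro τ hτ
    obtain rfl : τ = _ := by simpa using hτ
    constructor <;> simp +contextual [Prog.asks, Prog.regs, State.setReg]
  | call a i _ _ =>
    intro τ hτ
    obtain ⟨c, -, rfl⟩ := (PMF.mem_support_map_iff _ _ _).1 hτ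
    constructor <;> simp +contextual [Prog.asks, Prog.regs, State.setReg]

/-! ### Triples for deterministic runs -/

/-- Started in `σ`, the program `s` halts, without using its coin tosses, in a state that
satisfies `Q`. -/
def Tri (I : Instance) (O : Option (Finset ℕ → Bool)) (s : Prog) (σ : State)
    (Q : State → Prop) : Prop :=
  ∃ τ, Exec I O s σ (PMF.pure τ) ∧ Q τ

section Tri

variable {s s₁ s₂ : Prog} {σ : State} {Q Q' : State → Prop}

theorem Tri.conseq (h : Tri I O s σ Q) (hQ : ∀ τ, Frame s σ τ → Q τ → Q' τ) :
    Tri I O s σ Q' := by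
  obtain ⟨τ, h₁, h₂⟩ := h
  exact ⟨τ, h₁, hQ τ (h₁.frame τ (by simp)) h₂⟩

theorem Tri.set {i : ℕ} {e : Term} (h : Q ((σ.setReg i (e.eval I σ)).tick 1)) :
    Tri I O (.set i e) σ Q :=
  ⟨_, .set i e σ, h⟩

theorem Tri.store {a : ℕ} {e₁ e₂ : Term}
    (h : Q ((σ.setCell a (e₁.eval I σ) (e₂.eval I σ)).tick 1)) : Tri I O (.store a e₁ e₂) σ Q :=
  ⟨_, .store a e₁ e₂ σ, h⟩

theorem Tri.emit {a : ℕ}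
    (h : Q ({ σ with out := σ.out ++ [σ.subset I.n a] }.tick (I.n + 1))) :
    Tri I O (.emit a) σ Q :=
  ⟨_, .emit a σ, h⟩

theorem Tri.seq (h : Tri I O s₁ σ fun τ => Tri I O s₂ τ Q) : Tri I O (.seq s₁ s₂) σ Q := by
  obtain ⟨τ, h₁, ρ, h₂, hQ⟩ := h
  refine ⟨ρ, ?_, hQ⟩
  have := Exec.seq (κ := fun _ => PMF.pure ρ) h₁ fun τ' hτ' => by
    obtain rfl : τ' = τ := by simpa using hτ'
    exact h₂
  simpa using this

theorem Tri.set_seq {i : ℕ} {e : Term} (h : Tri I O s ((σ.setReg i (e.eval I σ)).tick 1) Q) :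
    Tri I O (.seq (.set i e) s) σ Q :=
  Tri.seq (Tri.set h)

theorem Tri.cond {b : Term} (h₁ : b.eval I σ ≠ 0 → Tri I O s₁ (σ.tick 1) Q)
    (h₂ : b.eval I σ = 0 → Tri I O s₂ (σ.tick 1) Q) : Tri I O (.cond b s₁ s₂) σ Q := by
  by_cases hb : b.eval I σ = 0
  · obtain ⟨τ, h, hQ⟩ := h₂ hb
    exact ⟨τ, .condFalse hb h, hQ⟩
  · obtain ⟨τ, h, hQ⟩ := h₁ hb
    exact ⟨τ, .condTrue hb h, hQ⟩

theorem Tri.loop_stop {b : Term} (hb : b.eval I σ = 0) (h : Q (σ.tick 1)) :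
    Tri I O (.loop b s) σ Q :=
  ⟨_, .loopStop hb, h⟩

theorem Tri.loop_step {b : Term} (hb : b.eval I σ ≠ 0)
    (h : Tri I O s (σ.tick 1) fun τ => Tri I O (.loop b s) τ Q) : Tri I O (.loop b s) σ Q := by
  obtain ⟨τ, h₁, ρ, h₂, hQ⟩ := h
  refine ⟨ρ, ?_, hQ⟩
  have := Exec.loopStep (κ := fun _ => PMF.pure ρ) hb h₁ fun τ' hτ' => by
    obtain rfl : τ' = τ := by simpa using hτ'
    exact h₂
  simpa using this

end Tri

/-- `for r := 0 to e - 1 do s`. -/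
def forLoop (r : ℕ) (e : Term) (s : Prog) : Prog :=
  .seq (.set r (.lit 0)) (.loop (.lt (.reg r) e) (.seq s (.set r (.add (.reg r) (.lit 1)))))

theorem Frame.forLoop_init (r : ℕ) (e : Term) (s : Prog) (σ : State) :
    Frame (forLoop r e s) σ ((σ.setReg r 0).tick 1) := by
  constructor <;> simp +contextual [forLoop, Prog.regs]

theorem Frame.forLoop_step {r v : ℕ} {e : Term} {s : Prog} {σ τ ρ : State}
    (h : Frame (forLoop r e s) σ τ) (h' : Frame s (τ.tick 1) ρ) :
    Frame (forLoop r e s) σ ((ρ.setReg r v).tick 1) := by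
  have h₁ : Frame (WitnessEnum.forLoop r e s) τ ρ := h'.tick_left.seq_left.mono
    (s := .seq s (.set r (.add (.reg r) (.lit 1))))
    (by simp [WitnessEnum.forLoop, Prog.regs])
    (by simp [WitnessEnum.forLoop, Prog.arrs]) (by simp [WitnessEnum.forLoop, Prog.emits])
    (by simp [WitnessEnum.forLoop, Prog.asks])
  refine h.trans (h₁.trans ?_)
  constructor <;> simp +contextual [WitnessEnum.forLoop, Prog.regs]

/-- Invariant rule with a clock: t + 2 pays for the body, the test and the increment, and the last
failing test is the final tick. The frame relation to the initial state is available at each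
iteration, so `Inv` need only mention what the body changes. -/
theorem Tri.forLoop {r e s σ} {Q : State → Prop} (N t : ℕ)
    (Inv : ℕ → State → Prop) (hr : r ∉ s.regs)
    (h₀ : Inv 0 ((σ.setReg r 0).tick 1))
    (hN : ∀ τ, Frame (forLoop r e s) σ τ → e.eval I τ = N)
    (hs : ∀ j < N, ∀ τ, Frame (forLoop r e s) σ τ → τ.reg r = j → Inv j τ →
      Tri I O s (τ.tick 1) fun ρ =>
        ρ.time ≤ τ.time + 1 + t ∧ Inv (j + 1) ((ρ.setReg r (j + 1)).tick 1))
    (hQ : ∀ τ, Frame (forLoop r e s) σ τ → τ.time ≤ σ.time + 1 + N * (t + 2) → Inv N τ →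
      Q (τ.tick 1)) :
    Tri I O (forLoop r e s) σ Q := by
  have main : ∀ m j τ, j + m = N → Frame (WitnessEnum.forLoop r e s) σ τ →
      τ.time ≤ σ.time + 1 + j * (t + 2) → τ.reg r = j → Inv j τ →
      Tri I O (.loop (.lt (.reg r) e) (.seq s (.set r (.add (.reg r) (.lit 1))))) τ Q := by
    intro m
    induction m with
    | zero =>
      intro j τ hj hF ht hr' hI
      obtain rfl : j = N := by omega
      refine Tri.loop_stop ?_ (hQ τ hF ht hI)
      simp [Term.eval, hN τ hF, hr']
    | succ m ih =>
      intro j τ hj hF ht hr' hI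
      refine Tri.loop_step ?_ ?_
      · simp [Term.eval, hN τ hF, hr']; omega
      · refine Tri.seq ?_
        refine (hs j (by omega) τ hF hr' hI).conseq fun ρ hρ hI' => ?_
        refine Tri.set ?_
        have hrr : ρ.reg r = j := by rw [hρ.reg r hr]; exact hr'
        simp only [Term.eval, hrr]
        refine ih (j + 1) _ (by omega) (hF.forLoop_step hρ) ?_ (by simp) hI'.2
        have := hI'.1
        simp only [State.tick_time, State.setReg_time]
        rw [add_mul]
        omega
  refine Tri.set_seq ?_
  exact main N 0 _ (by omega) (Frame.forLoop_init ..) (by simp) (by simp [Term.eval]) h₀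

/-! ### Triples for runs with uniformly distributed coin tosses -/

/-- Started in `σ`, the program `s` halts; there is a uniformly distributed random variable `ω` in `Ω`
such that the final state is a function of `ω` that satisfies `Q ω`. -/
def RTri (I : Instance) (O : Option (Finset ℕ → Bool)) (Ω : Type) [Fintype Ω] [Nonempty Ω]
    (s : Prog) (σ : State) (Q : Ω → State → Prop) : Prop :=
  ∃ F : Ω → State, Exec I O s σ ((PMF.uniformOfFintype Ω).map F) ∧ ∀ ω, Q ω (F ω)

theorem uniform_map_equiv {α β : Type} [Fintype α] [Nonempty α] [Fintype β] [Nonempty β]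
    (e : α ≃ β) : (PMF.uniformOfFintype α).map e = PMF.uniformOfFintype β := by
  classical
  ext b
  rw [PMF.map_apply, tsum_eq_single (e.symm b)]
  · simp [Fintype.card_congr e]
  · intro a ha
    rw [if_neg]
    rintro rfl
    simp at ha

/-- Two successive independent uniform draws form one uniform draw from the product, so a loop of
coin tosses still has a single finite sample space. -/
theorem uniform_bind_map {α β γ : Type} [Fintype α] [Nonempty α] [Fintype β] [Nonempty β]
    (f : α → β → γ) :
    ((PMF.uniformOfFintype α).bind fun a => (PMF.uniformOfFintype β).map (f a)) =
      (PMF.uniformOfFintype (α × β)).map fun p => f p.1 p.2 := by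
  have h : (PMF.uniformOfFintype (α × β)) =
      (PMF.uniformOfFintype α).bind fun a => (PMF.uniformOfFintype β).map fun b => (a, b) := by
    classical
    ext ⟨a, b⟩
    rw [PMF.bind_apply, tsum_eq_single a, PMF.map_apply, tsum_eq_single b]
    · simp [ENNReal.mul_inv]
    · intro b' hb'
      simp [Ne.symm hb']
    · intro a' ha'
      rw [PMF.map_apply]
      simp [Ne.symm ha']
  rw [h, PMF.map_bind]
  simp [PMF.map_comp, Function.comp_def]

section RTri

variable {Ω Γ : Type} [Fintype Ω] [Nonempty Ω] [Fintype Γ] [Nonempty Γ]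
  {s s₁ s₂ : Prog} {σ : State}

theorem RTri.conseq {Q Q' : Ω → State → Prop} (h : RTri I O Ω s σ Q)
    (hQ : ∀ ω τ, Frame s σ τ → Q ω τ → Q' ω τ) : RTri I O Ω s σ Q' := by
  obtain ⟨F, h₁, h₂⟩ := h
  refine ⟨F, h₁, fun ω => hQ ω _ ?_ (h₂ ω)⟩
  exact h₁.frame _ ((PMF.mem_support_map_iff _ _ _).2 ⟨ω, by simp, rfl⟩)

theorem RTri.flip {i : ℕ} {Q : Bool → State → Prop}
    (h : ∀ c, Q c ((σ.setReg i c.toNat).tick 1)) : RTri I O Bool (.flip i) σ Q :=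
  ⟨_, .flip i σ, h⟩

theorem RTri.seq_tri {Q : Ω → State → Prop}
    (h : RTri I O Ω s₁ σ fun ω τ => Tri I O s₂ τ (Q ω)) : RTri I O Ω (.seq s₁ s₂) σ Q := by
  obtain ⟨F, h₁, h₂⟩ := h
  choose G hG hQ using h₂
  exact ⟨G, Exec.seq_map h₁ hG, hQ⟩

theorem RTri.tri_seq {Q : Ω → State → Prop}
    (h : Tri I O s₁ σ fun τ => RTri I O Ω s₂ τ Q) : RTri I O Ω (.seq s₁ s₂) σ Q := by
  obtain ⟨τ, h₁, G, hG, hQ⟩ := h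
  refine ⟨G, ?_, hQ⟩
  have := Exec.seq (κ := fun _ => (PMF.uniformOfFintype Ω).map G) h₁ fun τ' hτ' => by
    obtain rfl : τ' = τ := by simpa using hτ'
    exact hG
  simpa using this

theorem RTri.cond {b : Term} {Q : Ω → State → Prop}
    (h₁ : b.eval I σ ≠ 0 → RTri I O Ω s₁ (σ.tick 1) Q)
    (h₂ : b.eval I σ = 0 → RTri I O Ω s₂ (σ.tick 1) Q) : RTri I O Ω (.cond b s₁ s₂) σ Q := by
  by_cases hb : b.eval I σ = 0
  · obtain ⟨τ, h, hQ⟩ := h₂ hb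
    exact ⟨τ, .condFalse hb h, hQ⟩
  · obtain ⟨τ, h, hQ⟩ := h₁ hb
    exact ⟨τ, .condTrue hb h, hQ⟩

/-- A deterministic run is a constant random variable on any sample space; branches that toss no
coin can thus share the sample space of the keys. -/
theorem Tri.to_rTri {Q : Ω → State → Prop} (h : Tri I O s σ fun τ => ∀ ω, Q ω τ) :
    RTri I O Ω s σ Q := by
  obtain ⟨τ, h₁, h₂⟩ := h
  refine ⟨fun _ => τ, ?_, h₂⟩
  convert h₁ using 1
  exact PMF.map_const _ _

theorem RTri.loop_step {b : Term} {Q : Ω × Γ → State → Prop} (hb : b.eval I σ ≠ 0)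
    (h : RTri I O Ω s (σ.tick 1) fun ω τ => RTri I O Γ (.loop b s) τ fun γ => Q (ω, γ)) :
    RTri I O (Ω × Γ) (.loop b s) σ Q := by
  obtain ⟨F, h₁, h₂⟩ := h
  choose G hG hQ using h₂
  refine ⟨fun p => G p.1 p.2, ?_, fun ω => hQ _ _⟩
  rw [← uniform_bind_map]
  exact Exec.loop_map hb h₁ hG

theorem RTri.equiv {Q : Γ → State → Prop} (e : Ω ≃ Γ)
    (h : RTri I O Ω s σ fun ω => Q (e ω)) : RTri I O Γ s σ Q := by
  obtain ⟨F, h₁, h₂⟩ := h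
  refine ⟨F ∘ e.symm, ?_, fun γ => ?_⟩
  · rw [← uniform_map_equiv e, PMF.map_comp]
    simpa [Function.comp_def] using h₁
  · simpa using h₂ (e.symm γ)

end RTri

/-! ### The search tree

Every element `u` of the universe has a key. A node of height `h` is given by a number `m`, whose
binary digits are split cyclically into `k` rows; an element matches a row if the row is the key
without its last `h` bits. -/

/-- The number formed by the lowest bits of the base-`B` digits of `q`. -/
def row (B q : ℕ) : ℕ :=
  if h : q = 0 ∨ B ≤ 1 then 0 else
    have : q / B < q := Nat.div_lt_self (by omega) (by omega)
    q % 2 + 2 * row B (q / B)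

/-- The `i`-th of the `k` rows of `m`. -/
def rows (k m i : ℕ) : ℕ := row (2 ^ k) (m / 2 ^ i)

/-- The elements that match some row of the node `m` of height `h`. -/
def cand (n k : ℕ) (key : ℕ → ℕ) (h m : ℕ) : Finset ℕ :=
  (Finset.range n).filter fun u => ∃ i < k, key u / 2 ^ h = rows k m i

/-- The node `m` of height `h` has nondecreasing rows, each of which is matched by some element, and
the oracle accepts the set of matching elements. -/
structure Live (f : Finset ℕ → Bool) (n k : ℕ) (key : ℕ → ℕ) (h m : ℕ) : Prop where
  matched : ∀ i < k, ∃ u < n, key u / 2 ^ h = rows k m i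
  sorted : ∀ i, i + 1 < k → rows k m i ≤ rows k m (i + 1)
  accepted : f (cand n k key h m) = true

/-! ### The algorithm

Registers: `0` answer, `1`, `2`, `3` loop counters, `4` number of bits of `n`, `5` number of random bits
of a key, `6` number of bits of a key, `7` power of two, `8` degree of the tree, `9` and `10` values
of `14` and `15` at the root, `11` coin, `12` key, `13` position, `14` and `15` the powers `2 ^ h` and
`2 ^ (k * h)` for the current height `h`, `16` loop flag, `17`, `18`, `19`, `20` computation of a row,
`21` previous row, `22` row is matched, `23` rows are nondecreasing and matched.
Arrays: `0` current set, `1` keys, `2` always empty. -/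

/-- An oracle call, or its replacement by a procedure. -/
def ask (D : Option Prog) (a i : ℕ) : Prog :=
  match D with
  | none => .query a i
  | some D => .call D a i

def skip : Prog := .set 0 (.reg 0)

/-- Double the register `r` as often as `e` says. -/
def doubling (r : ℕ) (e : Term) : Prog := forLoop 3 e (.set r (.add (.reg r) (.reg r)))

def sizeLoop : Prog :=
  .loop (.lt (.reg 7) (.add .univ (.lit 1)))
    (.seq (.set 7 (.add (.reg 7) (.reg 7))) (.set 4 (.add (.reg 4) (.lit 1))))

def setup : Prog :=
  .seq (.set 4 (.lit 0)) <| .seq (.set 7 (.lit 1)) <| .seq sizeLoop <|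
  .seq (.set 5 (.lit 0)) <|
  .seq (forLoop 2 (.add .param (.lit 2)) (.set 5 (.add (.reg 5) (.reg 4)))) <|
  .seq (.set 6 (.add (.reg 5) (.reg 4))) <|
  .seq (.set 8 (.lit 1)) <| .seq (doubling 8 .param) <|
  .seq (.set 9 (.lit 1)) <| .seq (doubling 9 (.reg 6)) <|
  .seq (.set 10 (.lit 1)) <| forLoop 2 .param (doubling 10 (.reg 6))

def drawBits : Prog :=
  forLoop 3 (.reg 5) (.seq (.flip 11) (.set 12 (.add (.add (.reg 12) (.reg 12)) (.reg 11))))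

def drawKey : Prog :=
  .seq (.set 12 (.lit 0)) <| .seq drawBits <|
  .seq (doubling 12 (.reg 4)) <| .store 1 (.reg 1) (.add (.reg 12) (.reg 1))

def drawKeys : Prog := forLoop 1 .univ drawKey

def rowLoop : Prog :=
  .loop (.reg 18) <|
    .seq (.cond (.mod (.reg 18) (.lit 2)) (.set 19 (.add (.reg 19) (.reg 20))) skip) <|
    .seq (.set 20 (.add (.reg 20) (.reg 20))) <| .set 18 (.div (.reg 18) (.reg 8))

def matchLoop : Prog :=
  forLoop 1 .univ <|
    .cond (.eq (.div (.cell 1 (.reg 1)) (.reg 14)) (.reg 19))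
      (.seq (.store 0 (.reg 1) (.lit 1)) (.set 22 (.lit 1))) skip

def rowTest : Prog :=
  .seq (.set 18 (.reg 17)) <| .seq (.set 19 (.lit 0)) <| .seq (.set 20 (.lit 1)) <|
  .seq rowLoop <| .seq (.set 22 (.lit 0)) <| .seq matchLoop <|
  -- A conjunction by counting: three bits sum to 3 iff the earlier rows were good, this row is
  -- matched, and it is not below the previous row.
  .seq (.set 23 (.eq (.add (.add (.reg 23) (.reg 22)) (.lt (.reg 21) (.add (.reg 19) (.lit 1))))
    (.lit 3))) <|
  .seq (.set 21 (.reg 19)) <| .set 17 (.div (.reg 17) (.lit 2))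

def fill (v : ℕ) : Prog := forLoop 1 .univ (.store 0 (.reg 1) (.lit v))

def nodeTest (D : Option Prog) : Prog :=
  .seq (fill 0) <| .seq (.set 23 (.lit 1)) <| .seq (.set 21 (.lit 0)) <|
  .seq (.set 17 (.div (.reg 13) (.reg 15))) <| .seq (forLoop 2 .param rowTest) <|
  .seq (.set 0 (.lit 0)) <| .cond (.reg 23) (ask D 0 0) skip

/-- Go down from the root towards the leaf given by the position, until a node fails the test. -/
def descend (D : Option Prog) : Prog :=
  .loop (.reg 16) <| .seq (nodeTest D) <|
    .cond (.reg 0)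
      (.cond (.eq (.reg 14) (.lit 1)) (.seq (.emit 0) (.set 16 (.lit 0)))
        (.seq (.set 14 (.div (.reg 14) (.lit 2))) (.set 15 (.div (.reg 15) (.reg 8)))))
      (.set 16 (.lit 0))

/-- Descend from the root repeatedly; after each descent, leave out all leaves below its last node. -/
def explore (D : Option Prog) : Prog :=
  .seq (.set 13 (.lit 0)) <|
  .loop (.lt (.reg 13) (.reg 10)) <|
    .seq (.set 14 (.reg 9)) <| .seq (.set 15 (.reg 10)) <| .seq (.set 16 (.lit 1)) <|
    .seq (descend D) <|
    -- Register 15 is now the number of leaves below the last node; this is the first leaf after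
    -- that block.
    .set 13 (.add (.sub (.reg 13) (.mod (.reg 13) (.reg 15))) (.reg 15))

/-- The enumeration algorithm. -/
def enumAlg (D : Option Prog) : Prog :=
  .seq (fill 1) <| .seq (ask D 0 0) <|
  -- The call on the whole universe settles N = 0. The case k = 0, where the only witness is empty,
  -- has no rows. For n < 2 and k ≥ 1 the only witness is the universe, and no further call is
  -- affordable because the logarithm in the bound is 0.
  .cond (.reg 0)
    (.cond (.eq .param (.lit 0)) (.emit 2)
      (.cond (.lt .univ (.lit 2)) (.emit 0)
        (.seq setup (.seq drawKeys (explore D)))))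
    skip

/-- Linking only changes the parameter of `enumAlg`, so one analysis under `AskSpec` serves both the
oracle and the procedure. -/
theorem link_enumAlg (D : Prog) : (enumAlg none).link D = enumAlg (some D) := rfl

/-- `ask D` answers according to `f` and takes time at most `T` beyond the time for handing over the
set. -/
def AskSpec (I : Instance) (O : Option (Finset ℕ → Bool)) (D : Option Prog) (f : Finset ℕ → Bool)
    (T : ℕ) : Prop :=
  ∀ σ a i, Tri I O (ask D a i) σ fun τ => τ.time ≤ σ.time + (I.n + 1 + T) ∧
    τ.reg i = (f (σ.subset I.n a)).toNat ∧ τ.calls ≤ σ.calls + 1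

theorem askSpec_query (I : Instance) (f : Finset ℕ → Bool) : AskSpec I (some f) none f 0 :=
  fun σ a i => ⟨_, .query a i σ rfl, by simp [State.setReg], by simp [State.setReg], by simp⟩

theorem askSpec_call {I : Instance} {𝒲 : Finset (Finset ℕ)} {D : Prog} {T : ℕ}
    (h : ∀ X ⊆ Finset.range I.n, DecidesWithin I 𝒲 D X T) :
    AskSpec I none (some D) (ora 𝒲) T := by
  intro σ a i
  obtain ⟨τ, h₁, h₂, h₃⟩ := h (σ.subset I.n a) (Finset.filter_subset _ _)
  have hE := Exec.call (σ := σ) a i h₁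
  rw [PMF.pure_map] at hE
  refine ⟨_, hE, ?_, ?_, ?_⟩
  · simp [State.setReg]
    omega
  · by_cases h0 : τ.reg 0 = 0
    · have : ora 𝒲 (σ.subset I.n a) = false := by simpa [h0] using h₂
      simp [State.setReg, h0, this]
    · have : ora 𝒲 (σ.subset I.n a) = true := by simpa [h0] using h₂
      simp [State.setReg, h0, this]
  · have := h₁.calls_eq τ (by simp)
    simp [State.start, State.init] at this
    simp [this]

@[simp] theorem ask_regs (D : Option Prog) (a i : ℕ) : (ask D a i).regs = [i] := by
  cases D <;> rfl
@[simp] theorem ask_arrs (D : Option Prog) (a i : ℕ) : (ask D a i).arrs = [] := by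
  cases D <;> rfl
@[simp] theorem ask_emits (D : Option Prog) (a i : ℕ) : (ask D a i).emits = false := by
  cases D <;> rfl

/-! ### Correctness and cost of the parts of the algorithm -/

theorem tri_skip {σ : State} {Q : State → Prop} (h : Q (σ.tick 1)) : Tri I O skip σ Q := by
  refine Tri.set ?_
  simpa [Term.eval, State.setReg] using h

theorem tri_doubling {r : ℕ} {e : Term} {σ : State} (N : ℕ) (hr : r ≠ 3)
    (he : ∀ τ, Frame (doubling r e) σ τ → e.eval I τ = N) :
    Tri I O (doubling r e) σ fun τ =>
      τ.time ≤ σ.time + (N * 3 + 2) ∧ τ.reg r = σ.reg r * 2 ^ N := by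
  refine Tri.forLoop N 1 (fun j τ => τ.reg r = σ.reg r * 2 ^ j) ?_ ?_ he ?_ ?_
  · simpa [Prog.regs] using hr.symm
  · simp [hr]
  · intro j _ τ _ _ h
    refine Tri.set ?_
    simp [Term.eval, hr, h, pow_succ]
    ring
  · intro τ _ ht h
    simp only [State.tick_time, State.tick_reg]
    exact ⟨by omega, h⟩

/-- The number of bits of `n`. -/
abbrev width (n : ℕ) : ℕ := Nat.log 2 n + 1

/-- Register 7 doubles until it exceeds n. For n = 0 the loop would not run at all, although `width
0 = 1`. -/
theorem tri_sizeLoop {σ : State} (h4 : σ.reg 4 = 0) (h7 : σ.reg 7 = 1) (hn : I.n ≠ 0) :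
    Tri I O sizeLoop σ fun τ => τ.time ≤ σ.time + (width I.n * 3 + 1) ∧ τ.reg 4 = width I.n := by
  have key : ∀ m j (τ : State), j + m = width I.n → τ.time ≤ σ.time + j * 3 → τ.reg 4 = j →
      τ.reg 7 = 2 ^ j → Tri I O sizeLoop τ fun τ =>
        τ.time ≤ σ.time + (width I.n * 3 + 1) ∧ τ.reg 4 = width I.n := by
    intro m
    induction m with
    | zero =>
      intro j τ hj ht h4 h7
      have : I.n < 2 ^ j := by
        rw [show j = Nat.log 2 I.n + 1 from hj]; exact Nat.lt_pow_succ_log_self (by norm_num) _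
      refine Tri.loop_stop ?_ ?_
      · simp [Term.eval, h7]; omega
      · simp only [State.tick_time, State.tick_reg]
        exact ⟨by omega, by omega⟩
    | succ m ih =>
      intro j τ hj ht h4 h7
      have : 2 ^ j ≤ I.n := (Nat.pow_le_pow_right (by norm_num)
        (by unfold width at hj; omega)).trans (Nat.pow_log_le_self 2 hn)
      refine Tri.loop_step ?_ ?_
      · simp [Term.eval, h7]; omega
      · refine Tri.set_seq (Tri.set ?_)
        refine ih (j + 1) _ (by omega) ?_ (by simp [Term.eval, h4]) ?_
        · simp; omega
        · simp [Term.eval, h7, pow_succ]; ring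
  exact key (width I.n) 0 σ (by omega) (by omega) h4 h7

/-- In place of multiplication, products come from repeated addition and powers from repeated
doubling; (2^k)^T takes k rounds of T doublings. -/
theorem tri_setup {σ : State} (hn : I.n ≠ 0) :
    Tri I O setup σ fun τ => τ.time ≤ σ.time + 20 * (I.k + 3) ^ 2 * width I.n ∧
      τ.reg 4 = width I.n ∧ τ.reg 5 = (I.k + 2) * width I.n ∧ τ.reg 8 = 2 ^ I.k ∧
      τ.reg 9 = 2 ^ ((I.k + 3) * width I.n) ∧
      τ.reg 10 = (2 ^ I.k) ^ ((I.k + 3) * width I.n) := by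
  refine Tri.set_seq (Tri.set_seq (Tri.seq ?_))
  refine (tri_sizeLoop (by simp [Term.eval]) (by simp [Term.eval]) hn).conseq ?_
  rintro τ₁ - ⟨ht₁, h4⟩
  refine Tri.set_seq (Tri.seq ?_)
  refine Tri.forLoop (I.k + 2) 1 (fun j τ => τ.reg 5 = j * width I.n)
    (by simp [Prog.regs]) (by simp [Term.eval]) (by simp [Term.eval]) ?_ ?_
  · intro j _ τ hF _ h5
    refine Tri.set ?_
    simp [Term.eval, hF.reg 4 (by decide), h4, h5, add_mul]
  intro τ₂ hF₂ ht₂ h5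
  have h4 : τ₂.reg 4 = width I.n := by rw [hF₂.reg 4 (by decide)]; simpa using h4
  refine Tri.set_seq (Tri.set_seq (Tri.seq ?_))
  refine (tri_doubling I.k (by norm_num) (by simp [Term.eval])).conseq ?_
  rintro τ₃ hF₃ ⟨ht₃, h8⟩
  have h4 : τ₃.reg 4 = width I.n := by rw [hF₃.reg 4 (by decide)]; simpa using h4
  have h6 : τ₃.reg 6 = (I.k + 3) * width I.n := by
    rw [hF₃.reg 6 (by decide)]
    simp [Term.eval, h5, ‹τ₂.reg 4 = _›]
    ring
  have h5 : τ₃.reg 5 = (I.k + 2) * width I.n := by rw [hF₃.reg 5 (by decide)]; simpa using h5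
  have h8 : τ₃.reg 8 = 2 ^ I.k := by simpa [Term.eval] using h8
  refine Tri.set_seq (Tri.seq ?_)
  refine (tri_doubling ((I.k + 3) * width I.n) (by norm_num)
    (fun τ hτ => by simpa [Term.eval, hτ.reg 6 (by decide)] using h6)).conseq ?_
  rintro τ₄ hF₄ ⟨ht₄, h9⟩
  have h9 : τ₄.reg 9 = 2 ^ ((I.k + 3) * width I.n) := by simpa [Term.eval] using h9
  have h6 : τ₄.reg 6 = (I.k + 3) * width I.n := by rw [hF₄.reg 6 (by decide)]; simpa using h6
  refine Tri.set_seq ?_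
  refine Tri.forLoop I.k ((I.k + 3) * width I.n * 3 + 2)
    (fun j τ => τ.reg 10 = (2 ^ j) ^ ((I.k + 3) * width I.n))
    (by decide) (by simp [Term.eval]) (by simp [Term.eval]) ?_ ?_
  · intro j _ τ hF _ h10
    refine (tri_doubling ((I.k + 3) * width I.n) (by norm_num)
      (fun τ hτ => by simpa [Term.eval, hτ.reg 6 (by decide), hF.reg 6 (by decide)] using h6)).conseq ?_
    rintro τ' - ⟨h, h'⟩
    refine ⟨h, ?_⟩
    simp only [State.tick_reg] at h'
    simp [h', h10]
    rw [← pow_mul, ← pow_mul, ← pow_add]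
    ring_nf
  · intro τ₅ hF₅ ht₅ h10
    refine ⟨?_, ?_, ?_, ?_, ?_, h10⟩
    · simp only [State.tick_time, State.setReg_time] at *
      have hb : 1 ≤ width I.n := by simp [width]
      generalize width I.n = b at *
      have : τ₅.time + 1 ≤ σ.time + (b * 3 + I.k * 3 + (I.k + 3) * b * 3 +
          ((I.k + 2) * 3 + I.k * ((I.k + 3) * b * 3 + 2 + 2)) + 20) := by
        omega
      nlinarith [Nat.zero_le (I.k * (b - 1)), mul_le_mul hb (le_refl I.k) (by omega) (by omega),
        mul_le_mul hb (le_refl (I.k * I.k)) (by positivity) (by omega)]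
    · rw [State.tick_reg, hF₅.reg 4 (by decide)]; simpa [hF₄.reg 4 (by decide)] using h4
    · rw [State.tick_reg, hF₅.reg 5 (by decide)]; simpa [hF₄.reg 5 (by decide)] using h5
    · rw [State.tick_reg, hF₅.reg 8 (by decide)]; simpa [hF₄.reg 8 (by decide)] using h8
    · rw [State.tick_reg, hF₅.reg 9 (by decide)]; simpa using h9

theorem tri_fill (v : ℕ) {σ : State} :
    Tri I O (fill v) σ fun τ => τ.time ≤ σ.time + (I.n * 3 + 2) ∧ ∀ u < I.n, τ.arr 0 u = v := by
  refine Tri.forLoop I.n 1 (fun j τ => ∀ u < j, τ.arr 0 u = v) (by simp [Prog.regs]) (by simp)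
    (by simp [Term.eval]) ?_ ?_
  · intro j _ τ _ hr h
    refine Tri.store ?_
    refine ⟨by simp, fun u hu => ?_⟩
    simp [Term.eval, hr]
    intro h'
    exact h u (by omega)
  · intro τ _ ht h
    exact ⟨by simp only [State.tick_time]; omega, h⟩

/-! ### Computing and testing the rows of a node. -/

theorem row_zero (B : ℕ) : row B 0 = 0 := by
  rw [row]; simp

theorem row_of_ne_zero {B q : ℕ} (hB : 2 ≤ B) (hq : q ≠ 0) :
    row B q = q % 2 + 2 * row B (q / B) := by
  rw [row, dif_neg (by omega)]

/-- Register 18 holds the remaining digits, 20 the current binary weight and 19 the partial sum; the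
quantity 19 + 20 · row(18) is invariant. The exponent d bounds the number of rounds. -/
theorem tri_rowLoop {B : ℕ} (hB : 2 ≤ B) (d : ℕ) : ∀ (σ : State), σ.reg 8 = B → σ.reg 18 < B ^ d →
    Tri I O rowLoop σ fun τ => τ.time ≤ σ.time + (d * 5 + 1) ∧
      τ.reg 19 = σ.reg 19 + σ.reg 20 * row B (σ.reg 18) := by
  induction d with
  | zero =>
    intro σ _ h
    have h0 : σ.reg 18 = 0 := by simpa using h
    refine Tri.loop_stop (by simpa [Term.eval] using h0) ?_
    simp [h0, row_zero]
  | succ d ih =>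
    intro σ h8 h
    by_cases h0 : σ.reg 18 = 0
    · refine Tri.loop_stop (by simpa [Term.eval] using h0) ?_
      simp [h0, row_zero]
    refine Tri.loop_step (by simpa [Term.eval] using h0) (Tri.seq ?_)
    have hd : σ.reg 18 / B < B ^ d := by
      rw [Nat.div_lt_iff_lt_mul (by omega), ← pow_succ]; exact h
    have hrow := row_of_ne_zero hB h0
    refine Tri.cond (fun hb => Tri.set (Tri.set_seq (Tri.set ?_)))
      (fun hb => tri_skip (Tri.set_seq (Tri.set ?_)))
    · refine (ih _ (by simpa using h8) (by simpa [Term.eval, h8] using hd)).conseq ?_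
      rintro τ - ⟨ht, h19⟩
      have hb : σ.reg 18 % 2 = 1 := by simp [Term.eval] at hb; omega
      refine ⟨by simp at ht; omega, ?_⟩
      rw [h19, hrow, hb]
      simp [Term.eval, h8]
      ring
    · refine (ih _ (by simpa using h8) (by simpa [Term.eval, h8] using hd)).conseq ?_
      rintro τ - ⟨ht, h19⟩
      have hb : σ.reg 18 % 2 = 0 := by simpa [Term.eval] using hb
      refine ⟨by simp at ht; omega, ?_⟩
      rw [h19, hrow, hb]
      simp [Term.eval, h8]
      ring

theorem tri_matchLoop {σ : State} {key : ℕ → ℕ} {h : ℕ} (hk : ∀ u < I.n, σ.arr 1 u = key u)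
    (h14 : σ.reg 14 = 2 ^ h) (h22 : σ.reg 22 = 0) :
    Tri I O matchLoop σ fun τ => τ.time ≤ σ.time + (I.n * 5 + 2) ∧
      (∀ u < I.n, τ.arr 0 u ≠ 0 ↔ σ.arr 0 u ≠ 0 ∨ key u / 2 ^ h = σ.reg 19) ∧
      τ.reg 22 ≤ 1 ∧ (τ.reg 22 = 1 ↔ ∃ u < I.n, key u / 2 ^ h = σ.reg 19) := by
  refine Tri.forLoop I.n 3 (fun j τ =>
    (∀ u < I.n, τ.arr 0 u ≠ 0 ↔ σ.arr 0 u ≠ 0 ∨ (u < j ∧ key u / 2 ^ h = σ.reg 19)) ∧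
      τ.reg 22 ≤ 1 ∧ (τ.reg 22 = 1 ↔ ∃ u < j, key u / 2 ^ h = σ.reg 19))
    (by decide) (by simp [h22]) (by simp [Term.eval]) ?_ ?_
  · rintro j hj τ hF hr ⟨hX, h22, h22'⟩
    have hev : Term.eval I (τ.tick 1)
        (.eq (.div (.cell 1 (.reg 1)) (.reg 14)) (.reg 19)) =
        if key j / 2 ^ h = σ.reg 19 then 1 else 0 := by
      simp [Term.eval, hF.arr 1 (by decide), hr, hk j hj, hF.reg 14 (by decide), h14,
        hF.reg 19 (by decide)]
    refine Tri.cond (fun hb => Tri.seq (Tri.store (Tri.set ?_))) (fun hb => tri_skip ?_)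
    · rw [hev] at hb
      have hj' : key j / 2 ^ h = σ.reg 19 := by by_contra h'; simp [h'] at hb
      refine ⟨by simp, fun u hu => ?_, by simp [Term.eval], ?_⟩
      · by_cases huj : u = j
        · subst huj; simp [Term.eval, hr, hj']
        · have := hX u hu
          have h1 : u < j + 1 ↔ u < j := by omega
          simpa [Term.eval, hr, huj, h1] using this
      · simp only [State.tick_reg, State.setReg_reg]
        simp [Term.eval]
        exact ⟨j, by omega, hj'⟩
    · rw [hev] at hb
      have hj' : key j / 2 ^ h ≠ σ.reg 19 := by intro h'; simp [h'] at hb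
      refine ⟨by simp, fun u hu => ?_, by simpa using h22, ?_⟩
      · have h1 : (u < j + 1 ∧ key u / 2 ^ h = σ.reg 19) ↔ (u < j ∧ key u / 2 ^ h = σ.reg 19) := by
          constructor
          · rintro ⟨h₁, h₂⟩
            refine ⟨lt_of_le_of_ne (by omega) ?_, h₂⟩
            rintro rfl; exact hj' h₂
          · rintro ⟨h₁, h₂⟩; exact ⟨by omega, h₂⟩
        rw [h1]
        simpa using hX u hu
      · simp only [State.tick_reg, State.setReg_reg]
        simp [h22']
        constructor
        · rintro ⟨u, h₁, h₂⟩; exact ⟨u, by omega, h₂⟩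
        · rintro ⟨u, h₁, h₂⟩
          refine ⟨u, lt_of_le_of_ne (by omega) ?_, h₂⟩
          rintro rfl; exact hj' h₂
  · rintro τ hF ht ⟨hX, h22⟩
    refine ⟨by simp only [State.tick_time]; omega, fun u hu => ?_, h22⟩
    simpa [hu] using hX u hu

theorem tri_rowTest {σ : State} {key : ℕ → ℕ} {h d : ℕ} (hk : ∀ u < I.n, σ.arr 1 u = key u)
    (hk0 : I.k ≠ 0) (h8 : σ.reg 8 = 2 ^ I.k) (h14 : σ.reg 14 = 2 ^ h)
    (h17 : σ.reg 17 < (2 ^ I.k) ^ d) (h23 : σ.reg 23 ≤ 1) :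
    Tri I O rowTest σ fun τ => τ.time ≤ σ.time + (d * 5 + I.n * 5 + 10) ∧
      τ.reg 17 = σ.reg 17 / 2 ∧ τ.reg 21 = row (2 ^ I.k) (σ.reg 17) ∧
      (∀ u < I.n, τ.arr 0 u ≠ 0 ↔ σ.arr 0 u ≠ 0 ∨ key u / 2 ^ h = row (2 ^ I.k) (σ.reg 17)) ∧
      τ.reg 23 ≤ 1 ∧ (τ.reg 23 = 1 ↔ σ.reg 23 = 1 ∧
        (∃ u < I.n, key u / 2 ^ h = row (2 ^ I.k) (σ.reg 17)) ∧
          σ.reg 21 ≤ row (2 ^ I.k) (σ.reg 17)) := by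
  have hB : 2 ≤ 2 ^ I.k := by
    calc 2 = 2 ^ 1 := rfl
      _ ≤ 2 ^ I.k := Nat.pow_le_pow_right (by norm_num) (by omega)
  refine Tri.set_seq (Tri.set_seq (Tri.set_seq (Tri.seq ?_)))
  refine (tri_rowLoop hB d _ (by simpa using h8) (by simpa [Term.eval] using h17)).conseq ?_
  rintro τ₁ hF₁ ⟨ht₁, h19⟩
  have h19 : τ₁.reg 19 = row (2 ^ I.k) (σ.reg 17) := by simpa [Term.eval] using h19
  refine Tri.set_seq (Tri.seq ?_)
  refine (tri_matchLoop (key := key) (h := h) ?_ ?_ ?_).conseq ?_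
  · intro u hu
    simpa [hF₁.arr 1 (by decide)] using hk u hu
  · simpa [hF₁.reg 14 (by decide)] using h14
  · simp [Term.eval]
  rintro τ₂ hF₂ ⟨ht₂, hX, h22, h22'⟩
  have e19 : τ₂.reg 19 = row (2 ^ I.k) (σ.reg 17) := by
    rw [hF₂.reg 19 (by decide)]; simpa using h19
  have e17 : τ₂.reg 17 = σ.reg 17 := by
    rw [hF₂.reg 17 (by decide)]; simp [hF₁.reg 17 (by decide)]
  have e21 : τ₂.reg 21 = σ.reg 21 := by
    rw [hF₂.reg 21 (by decide)]; simp [hF₁.reg 21 (by decide)]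
  have e23 : τ₂.reg 23 = σ.reg 23 := by
    rw [hF₂.reg 23 (by decide)]; simp [hF₁.reg 23 (by decide)]
  simp only [State.tick_arr, State.setReg_arr, hF₁.arr 0 (by decide), State.tick_reg,
    State.setReg_reg, h19] at hX h22'
  refine Tri.set_seq (Tri.set_seq (Tri.set ?_))
  refine ⟨?_, ?_, ?_, ?_, ?_, ?_⟩
  · simp only [State.tick_time, State.setReg_time] at *
    omega
  · simp [Term.eval, e17]
  · simp [Term.eval, e19]
  · intro u hu
    simpa using hX u hu
  · simp only [Term.eval, State.tick_reg, State.setReg_reg]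
    norm_num
    split_ifs <;> omega
  · simp [Term.eval, e23, e21, e19]
    have h22'' : τ₂.reg 22 = 1 ↔ ∃ u < I.n, key u / 2 ^ h = row (2 ^ I.k) (σ.reg 17) := by
      simpa using h22'
    rw [← h22'']
    split_ifs <;> omega

/-- A bound for the time of `nodeTest`. -/
def nodeTime (n k d T : ℕ) : ℕ := 4 * n + k * (d * 5 + n * 5 + 10 + 2) + 14 + T

theorem nodeTest_regs (D : Option Prog) : (nodeTest D).regs =
    [1, 1, 23, 21, 17, 2, 18, 19, 20, 19, 0, 20, 18, 22, 1, 22, 0, 1, 23, 21, 17, 2, 0, 0, 0] := by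
  cases D <;> rfl

theorem nodeTest_arrs (D : Option Prog) : (nodeTest D).arrs = [0, 0] := by
  cases D <;> rfl

theorem nodeTest_emits (D : Option Prog) : (nodeTest D).emits = false := by
  cases D <;> rfl

theorem tri_nodeTest {σ : State} {D : Option Prog} {f : Finset ℕ → Bool} {T : ℕ} {key : ℕ → ℕ}
    {h d : ℕ} (hD : AskSpec I O D f T) (hk : ∀ u < I.n, σ.arr 1 u = key u) (hk0 : I.k ≠ 0)
    (h8 : σ.reg 8 = 2 ^ I.k) (h14 : σ.reg 14 = 2 ^ h) (h15 : σ.reg 15 = (2 ^ I.k) ^ h)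
    (h13 : σ.reg 13 < (2 ^ I.k) ^ d) :
    Tri I O (nodeTest D) σ fun τ => τ.time ≤ σ.time + nodeTime I.n I.k d T ∧
      τ.calls ≤ σ.calls + 1 ∧
      (τ.reg 0 ≠ 0 ↔ Live f I.n I.k key h (σ.reg 13 / (2 ^ I.k) ^ h)) ∧
      τ.subset I.n 0 = cand I.n I.k key h (σ.reg 13 / (2 ^ I.k) ^ h) := by
  set m := σ.reg 13 / (2 ^ I.k) ^ h with hm
  have hmd : m < (2 ^ I.k) ^ d := (Nat.div_le_self _ _).trans_lt h13
  refine Tri.seq ((tri_fill 0).conseq ?_)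
  rintro τ₁ hF₁ ⟨ht₁, hX₁⟩
  refine Tri.set_seq (Tri.set_seq (Tri.set_seq (Tri.seq ?_)))
  -- After i rows, array 0 holds the elements matching one of them and register 23 tells whether
  -- they are matched and nondecreasing. Register 21 is the previous row; its initial value 0 makes
  -- the first comparison succeed.
  refine Tri.forLoop I.k (d * 5 + I.n * 5 + 10) (fun i τ => τ.reg 17 = m / 2 ^ i ∧
    (i = 0 → τ.reg 21 = 0) ∧ (∀ i', i = i' + 1 → τ.reg 21 = rows I.k m i') ∧
    (∀ u < I.n, τ.arr 0 u ≠ 0 ↔ ∃ i' < i, key u / 2 ^ h = rows I.k m i') ∧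
    τ.reg 23 ≤ 1 ∧ (τ.reg 23 = 1 ↔ (∀ i' < i, ∃ u < I.n, key u / 2 ^ h = rows I.k m i') ∧
      ∀ i', i' + 1 < i → rows I.k m i' ≤ rows I.k m (i' + 1))) (by decide) ?_ (by simp [Term.eval])
      ?_ ?_
  · refine ⟨?_, ?_, ?_, ?_, ?_, ?_⟩
    · simp [Term.eval, hF₁.reg 13 (by decide), hF₁.reg 15 (by decide), h15, hm]
    · simp [Term.eval]
    · simp
    · intro u hu
      simp [hX₁ u hu]
    · simp [Term.eval]
    · simp [Term.eval]
  · rintro i hi τ hF hr ⟨h17, h21, h21', hX, h23, h23'⟩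
    refine (tri_rowTest (key := key) (h := h) (d := d) ?_ hk0 ?_ ?_ ?_ ?_).conseq ?_
    · intro u hu
      simpa [hF.arr 1 (by decide), hF₁.arr 1 (by decide)] using hk u hu
    · simpa [hF.reg 8 (by decide), hF₁.reg 8 (by decide)] using h8
    · simpa [hF.reg 14 (by decide), hF₁.reg 14 (by decide)] using h14
    · simp only [State.tick_reg, h17]
      exact (Nat.div_le_self _ _).trans_lt hmd
    · simpa using h23
    · rintro ρ - ⟨ht, g17, g21, gX, g23, g23'⟩
      have hrow : row (2 ^ I.k) ((τ.tick 1).reg 17) = rows I.k m i := by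
        rw [State.tick_reg, h17]; rfl
      rw [hrow] at gX g23' g21
      refine ⟨by simpa using ht, ?_, by simp, ?_, ?_, by simpa using g23, ?_⟩
      · simp [g17, h17, pow_succ, Nat.div_div_eq_div_mul]
      · intro i' hi'
        obtain rfl : i = i' := by omega
        simpa using g21
      · intro u hu
        have h1 := gX u hu
        have h2 := hX u hu
        simp only [State.tick_arr, State.setReg_arr] at h1 ⊢
        rw [h1, h2]
        constructor
        · rintro (⟨i', hi', h⟩ | h)
          · exact ⟨i', by omega, h⟩
          · exact ⟨i, by omega, h⟩
        · rintro ⟨i', hi', h⟩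
          by_cases h' : i' = i
          · subst h'; exact .inr h
          · exact .inl ⟨i', by omega, h⟩
      · simp only [State.tick_reg, State.setReg_reg] at g23' ⊢
        rw [if_neg (by norm_num), g23', h23']
        constructor
        · rintro ⟨⟨h1, h2⟩, h3, h4⟩
          refine ⟨fun i' hi' => ?_, fun i' hi' => ?_⟩
          · by_cases h' : i' = i
            · subst h'; exact h3
            · exact h1 i' (by omega)
          · by_cases h' : i' + 1 = i
            · rw [h21' i' h'.symm] at h4
              rwa [h']
            · exact h2 i' (by omega)
        · rintro ⟨h1, h2⟩
          refine ⟨⟨fun i' hi' => h1 i' (by omega), fun i' hi' => h2 i' (by omega)⟩,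
            h1 i (by omega), ?_⟩
          rcases Nat.eq_zero_or_pos i with h0 | h0
          · simp [h21 h0]
          · obtain ⟨i', rfl⟩ : ∃ i', i = i' + 1 := ⟨i - 1, by omega⟩
            rw [h21' i' rfl]
            exact h2 i' (by omega)
  · rintro τ hF ht ⟨-, -, -, hX, h23, h23'⟩
    have hcand : ∀ ρ : State, ρ.arr 0 = τ.arr 0 → ρ.subset I.n 0 = cand I.n I.k key h m := by
      intro ρ hρ
      ext u
      simp only [State.subset, cand, Finset.mem_filter, Finset.mem_range, hρ]
      constructor
      · rintro ⟨h1, h2⟩; exact ⟨h1, (hX u h1).1 h2⟩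
      · rintro ⟨h1, h2⟩; exact ⟨h1, (hX u h1).2 h2⟩
    have hcalls : τ.calls = σ.calls := by
      rw [hF.calls (by decide)]; simp [hF₁.calls (by decide)]
    have htime : τ.time ≤ σ.time + (I.n * 3 + I.k * (d * 5 + I.n * 5 + 10 + 2) + 6) := by
      simp only [State.tick_time, State.setReg_time] at *
      omega
    refine Tri.set_seq (Tri.cond (fun hb => ?_) (fun hb => tri_skip ?_))
    · simp only [Term.eval, State.tick_reg, State.setReg_reg] at hb
      have h1 : τ.reg 23 = 1 := by simp at hb; omega
      refine (hD _ _ _).conseq ?_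
      rintro ρ hFρ ⟨ht', h0, hc⟩
      rw [hcand] at h0
      swap
      · rfl
      refine ⟨?_, ?_, ?_, hcand _ (hFρ.arr 0 (by simp))⟩
      · simp [nodeTime] at *; omega
      · simpa [hcalls] using hc
      · rw [h0]
        have := h23'.1 h1
        constructor
        · intro h2
          exact ⟨this.1, this.2, by by_contra h3; simp [h3] at h2⟩
        · intro h2
          simp [h2.accepted]
    · simp only [Term.eval, State.tick_reg, State.setReg_reg] at hb
      have h1 : τ.reg 23 = 0 := by simpa using hb
      refine ⟨?_, ?_, ?_, hcand _ rfl⟩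
      · simp [nodeTime] at *; omega
      · simp [hcalls]
      · simp [Term.eval]
        intro h2
        have := h23'.2 ⟨h2.matched, h2.sorted⟩
        omega

/-- One test per height, by induction on the starting height. The walk stops at height h' at a live
leaf, which is output, or at a node that is not live; all nodes visited above it are live. Register
15 is then the number of leaves below the last node. -/
theorem tri_descend {D : Option Prog} {f : Finset ℕ → Bool} {T : ℕ} {key : ℕ → ℕ}
    {d p : ℕ} (hD : AskSpec I O D f T) (hk0 : I.k ≠ 0) (hp : p < (2 ^ I.k) ^ d) (h : ℕ) :
    ∀ σ : State, (∀ u < I.n, σ.arr 1 u = key u) → σ.reg 8 = 2 ^ I.k → σ.reg 14 = 2 ^ h →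
      σ.reg 15 = (2 ^ I.k) ^ h → σ.reg 13 = p → σ.reg 16 = 1 →
    Tri I O (descend D) σ fun τ =>
      τ.time ≤ σ.time + ((h + 1) * (nodeTime I.n I.k d T + I.n + 10)) ∧
      τ.calls ≤ σ.calls + (h + 1) ∧
      ∃ h' ≤ h, (∀ j ≤ h, h' < j → Live f I.n I.k key j (p / (2 ^ I.k) ^ j)) ∧
        τ.reg 15 = (2 ^ I.k) ^ h' ∧
        ((h' = 0 ∧ Live f I.n I.k key 0 p ∧ τ.out = σ.out ++ [cand I.n I.k key 0 p]) ∨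
          (¬ Live f I.n I.k key h' (p / (2 ^ I.k) ^ h') ∧ τ.out = σ.out)) := by
  induction h with
  | zero =>
    intro σ hk h8 h14 h15 h13 h16
    refine Tri.loop_step (by simp [Term.eval, h16]) (Tri.seq ?_)
    refine (tri_nodeTest (σ := σ.tick 1) (key := key) (h := 0) (d := d) hD hk hk0 h8 h14 h15
      (by simpa [h13] using hp)).conseq ?_
    rintro τ hF ⟨ht, hc, hL, hX⟩
    simp only [State.tick_reg, h13] at hL hX
    simp only [pow_zero, Nat.div_one] at hL hX
    simp only [State.tick_time, State.tick_calls] at ht hc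
    have e14 : τ.reg 14 = 1 := by rw [hF.reg 14 (by simp [nodeTest_regs])]; simpa using h14
    have e15 : τ.reg 15 = 1 := by rw [hF.reg 15 (by simp [nodeTest_regs])]; simpa using h15
    have eo : τ.out = σ.out := hF.out (nodeTest_emits D)
    refine Tri.cond (fun hb => Tri.cond (fun _ => Tri.seq (Tri.emit (Tri.set ?_)))
      (fun hb' => ?_)) (fun hb => Tri.set ?_)
    · refine Tri.loop_stop (by simp [Term.eval]) ?_
      refine ⟨by simp; omega, by simpa using hc, 0, le_rfl, by omega, by simp [e15], .inl ?_⟩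
      have hXX : ((τ.tick 1).tick 1).subset I.n 0 = τ.subset I.n 0 := rfl
      refine ⟨rfl, hL.1 hb, ?_⟩
      simp [hXX, hX, eo]
    · simp [Term.eval, e14] at hb'
    · refine Tri.loop_stop (by simp [Term.eval]) ?_
      refine ⟨by simp; omega, by simpa using hc, 0, le_rfl, by omega, by simp [e15], .inr ?_⟩
      refine ⟨?_, by simp [eo]⟩
      simp only [pow_zero, Nat.div_one]
      exact fun h' => hL.2 h' hb
  | succ h ih =>
    intro σ hk h8 h14 h15 h13 h16
    refine Tri.loop_step (by simp [Term.eval, h16]) (Tri.seq ?_)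
    refine (tri_nodeTest (σ := σ.tick 1) (key := key) (h := h + 1) (d := d) hD hk hk0 h8 h14 h15
      (by simpa [h13] using hp)).conseq ?_
    rintro τ hF ⟨ht, hc, hL, hX⟩
    simp only [State.tick_reg, h13] at hL hX
    simp only [State.tick_time, State.tick_calls] at ht hc
    have e14 : τ.reg 14 = 2 ^ (h + 1) := by rw [hF.reg 14 (by simp [nodeTest_regs])]; simpa using h14
    have e15 : τ.reg 15 = (2 ^ I.k) ^ (h + 1) := by
      rw [hF.reg 15 (by simp [nodeTest_regs])]; simpa using h15
    have e8 : τ.reg 8 = 2 ^ I.k := by rw [hF.reg 8 (by simp [nodeTest_regs])]; simpa using h8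
    have eo : τ.out = σ.out := hF.out (nodeTest_emits D)
    refine Tri.cond (fun hb => Tri.cond (fun hb' => ?_)
      (fun _ => Tri.set_seq (Tri.set ?_))) (fun hb => Tri.set ?_)
    · simp [Term.eval, e14] at hb'
    · refine (ih _ ?_ ?_ ?_ ?_ ?_ ?_).conseq ?_
      · simpa [hF.arr 1 (by simp [nodeTest_arrs])] using hk
      · simpa using e8
      · simp [Term.eval, e14, pow_succ]
      · simp [Term.eval, e15, e8, pow_succ]
      · rw [← h13]; simp [hF.reg 13 (by simp [nodeTest_regs])]
      · simp [hF.reg 16 (by simp [nodeTest_regs]), h16]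
      · rintro ρ - ⟨ht', hc', h', hh', hlive, g15, gout⟩
        simp only [State.tick_time, State.setReg_time, State.tick_calls, State.setReg_calls,
          State.tick_out, State.setReg_out, eo] at ht' hc' gout
        refine ⟨?_, by omega, h', by omega, fun j hj hj' => ?_, g15, gout⟩
        · rw [add_mul _ 1]; omega
        · by_cases hjh : j = h + 1
          · subst hjh; exact hL.1 hb
          · exact hlive j (by omega) hj'
    · refine Tri.loop_stop (by simp [Term.eval]) ?_
      refine ⟨?_, by simp; omega, h + 1, le_rfl, by omega, by simp [e15], .inr ?_⟩
      · simp only [State.tick_time, State.setReg_time]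
        nlinarith
      · exact ⟨fun h' => hL.2 h' hb, by simp [eo]⟩

theorem Term.eval_lt_eq_zero {a b : Term} {σ : State} (h : b.eval I σ ≤ a.eval I σ) :
    (Term.lt a b).eval I σ = 0 := by
  simpa [Term.eval] using h

theorem Term.eval_lt_ne_zero {a b : Term} {σ : State} (h : a.eval I σ < b.eval I σ) :
    (Term.lt a b).eval I σ ≠ 0 := by
  simpa [Term.eval] using h

/-! ### Drawing the keys -/

/-- Prepend a binary digit. -/
def prependBit (m : ℕ) : Bool × Fin (2 ^ m) ≃ Fin (2 ^ (m + 1)) :=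
  (Equiv.prodCongrLeft fun _ => finTwoEquiv.symm).trans
    (finProdFinEquiv.trans (finCongr (by rw [pow_succ]; ring)))

/-- The first toss becomes the most significant bit, in agreement with the doubling in `drawBits`.
-/
theorem prependBit_val (m : ℕ) (c : Bool) (v : Fin (2 ^ m)) :
    (prependBit m (c, v) : ℕ) = c.toNat * 2 ^ m + v := by
  cases c <;> simp [prependBit, finTwoEquiv, add_comm]

theorem rTri_drawBits_loop (m : ℕ) : ∀ σ : State, σ.reg 3 + m = σ.reg 5 →
    RTri I O (Fin (2 ^ m))
      (.loop (.lt (.reg 3) (.reg 5)) (.seq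
        (.seq (.flip 11) (.set 12 (.add (.add (.reg 12) (.reg 12)) (.reg 11))))
        (.set 3 (.add (.reg 3) (.lit 1))))) σ
      fun v τ => τ.time ≤ σ.time + (m * 4 + 1) ∧ τ.reg 12 = σ.reg 12 * 2 ^ m + v := by
  induction m with
  | zero =>
    intro σ h
    refine Tri.to_rTri (Tri.loop_stop (Term.eval_lt_eq_zero (by simp only [Term.eval]; omega)) fun v => ?_)
    simp
  | succ m ih =>
    intro σ h
    refine RTri.equiv (prependBit m) (RTri.loop_step (Term.eval_lt_ne_zero (by simp only [Term.eval]; omega)) ?_)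
    refine RTri.seq_tri (RTri.seq_tri (RTri.flip fun c => Tri.set (Tri.set ?_)))
    refine (ih _ (by simp [Term.eval]; omega)).conseq ?_
    rintro v τ - ⟨ht, h12⟩
    refine ⟨?_, ?_⟩
    · simp only [State.tick_time, State.setReg_time] at ht
      omega
    · rw [h12, prependBit_val]
      simp [Term.eval]
      ring

theorem rTri_drawKey {σ : State} {L b : ℕ} (h5 : σ.reg 5 = L) (h4 : σ.reg 4 = b) :
    RTri I O (Fin (2 ^ L)) drawKey σ fun v τ => τ.time ≤ σ.time + (L * 4 + b * 3 + 6) ∧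
      τ.arr 1 (σ.reg 1) = v * 2 ^ b + σ.reg 1 ∧ ∀ u ≠ σ.reg 1, τ.arr 1 u = σ.arr 1 u := by
  refine RTri.tri_seq (Tri.set (RTri.seq_tri ?_))
  refine RTri.tri_seq (Tri.set ?_)
  refine (rTri_drawBits_loop L _ (by simp [Term.eval, h5])).conseq ?_
  rintro v τ₁ hF₁ ⟨ht₁, h12⟩
  refine Tri.seq ((tri_doubling b (by norm_num) ?_).conseq ?_)
  · intro τ hF
    simp [Term.eval, hF.reg 4 (by decide), hF₁.reg 4 (by decide), h4]
  rintro τ₂ hF₂ ⟨ht₂, g12⟩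
  refine Tri.store ?_
  have e1 : τ₂.reg 1 = σ.reg 1 := by
    simp [hF₂.reg 1 (by decide), hF₁.reg 1 (by decide)]
  refine ⟨?_, ?_, fun u hu => ?_⟩
  · simp only [State.tick_time, State.setReg_time, State.setCell_time] at *
    omega
  · simp [Term.eval, e1, g12, h12]
  · simp [Term.eval, e1, hu, hF₂.arr 1 (by decide), hF₁.arr 1 (by decide)]

theorem rTri_drawKeys_loop {L b : ℕ} (m : ℕ) : ∀ σ : State, σ.reg 5 = L → σ.reg 4 = b →
    σ.reg 1 + m = I.n →
    RTri I O (Fin m → Fin (2 ^ L))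
      (.loop (.lt (.reg 1) .univ) (.seq drawKey (.set 1 (.add (.reg 1) (.lit 1))))) σ
      fun κ τ => τ.time ≤ σ.time + (m * (L * 4 + b * 3 + 8) + 1) ∧
        (∀ u < σ.reg 1, τ.arr 1 u = σ.arr 1 u) ∧
        ∀ j : Fin m, τ.arr 1 (σ.reg 1 + j) = κ j * 2 ^ b + (σ.reg 1 + j) := by
  induction m with
  | zero =>
    intro σ _ _ h
    refine Tri.to_rTri (Tri.loop_stop (Term.eval_lt_eq_zero (by simp only [Term.eval]; omega)) fun v => ?_)
    simp
  | succ m ih =>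
    intro σ h5 h4 h
    refine RTri.equiv (Fin.consEquiv fun _ : Fin (m + 1) => Fin (2 ^ L))
      (RTri.loop_step (Term.eval_lt_ne_zero (by simp only [Term.eval]; omega)) ?_)
    refine RTri.seq_tri ((rTri_drawKey (σ := σ.tick 1) (L := L) (b := b) h5 h4).conseq ?_)
    rintro v τ hF ⟨ht, hv, hne⟩
    have e1 : τ.reg 1 = σ.reg 1 := hF.reg 1 (by decide)
    simp only [State.tick_reg, State.tick_arr, State.tick_time] at ht hv hne
    refine Tri.set ?_
    refine (ih _ ?_ ?_ ?_).conseq ?_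
    · simpa [hF.reg 5 (by decide)] using h5
    · simpa [hF.reg 4 (by decide)] using h4
    · simp [Term.eval, e1]; omega
    rintro κ ρ - ⟨ht', hlow, hκ⟩
    simp only [State.tick_reg, State.tick_arr, State.tick_time, State.setReg_reg, if_true,
      State.setReg_arr, State.setReg_time, Term.eval, e1] at ht' hlow hκ
    refine ⟨?_, fun u hu => ?_, ?_⟩
    · rw [add_mul]; omega
    · rw [hlow u (by omega), hne u (by omega)]
    · intro j
      refine Fin.cases ?_ (fun j => ?_) j
      · simpa [Fin.consEquiv] using (hlow (σ.reg 1) (by omega)).trans hv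
      · have := hκ j
        simp only [Fin.consEquiv, Equiv.coe_fn_mk, Fin.cons_succ, Fin.val_succ]
        rw [show σ.reg 1 + (j.val + 1) = σ.reg 1 + 1 + j.val by omega]
        exact this

/-- The key of `u`: random high-order bits, followed by the bits of `u`. -/
def keyOf {n L : ℕ} (κ : Fin n → Fin (2 ^ L)) (b u : ℕ) : ℕ :=
  if h : u < n then κ ⟨u, h⟩ * 2 ^ b + u else 0

theorem rTri_drawKeys {σ : State} {L b : ℕ} (h5 : σ.reg 5 = L) (h4 : σ.reg 4 = b) :
    RTri I O (Fin I.n → Fin (2 ^ L)) drawKeys σ fun κ τ =>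
      τ.time ≤ σ.time + (I.n * (L * 4 + b * 3 + 8) + 2) ∧
      ∀ u < I.n, τ.arr 1 u = keyOf κ b u := by
  refine RTri.tri_seq (Tri.set ?_)
  refine (rTri_drawKeys_loop (L := L) (b := b) I.n _ (by simpa using h5) (by simpa using h4)
    (by simp [Term.eval])).conseq ?_
  rintro κ τ - ⟨ht, -, hκ⟩
  refine ⟨by simp only [State.tick_time, State.setReg_time] at ht; omega, fun u hu => ?_⟩
  simpa [Term.eval, keyOf, hu] using hκ ⟨u, hu⟩

/-! ### Structure of the search tree -/

theorem row_div {B : ℕ} (hB : 2 ≤ B) (q : ℕ) : row B (q / B) = row B q / 2 := by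
  by_cases hq : q = 0
  · subst hq; simp [row_zero]
  · rw [row_of_ne_zero hB hq]; omega

/-- Removing the k lowest digits of m removes the lowest bit of every row, so m / 2^k is the parent
of m. -/
theorem rows_div {k : ℕ} (hk : k ≠ 0) (m i : ℕ) : rows k (m / 2 ^ k) i = rows k m i / 2 := by
  have hB : 2 ≤ 2 ^ k := by
    calc 2 = 2 ^ 1 := rfl
      _ ≤ 2 ^ k := Nat.pow_le_pow_right (by norm_num) (by omega)
  rw [rows, rows, Nat.div_div_eq_div_mul, mul_comm, ← Nat.div_div_eq_div_mul, row_div hB]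

/-- Truncation preserves matches and order and can only enlarge the candidate set, which a monotone
oracle still accepts. -/
theorem Live.parent {f : Finset ℕ → Bool} {n k : ℕ} {key : ℕ → ℕ} {h m : ℕ}
    (hf : ∀ X Y, X ⊆ Y → f X = true → f Y = true) (hk : k ≠ 0) (hL : Live f n k key h m) :
    Live f n k key (h + 1) (m / 2 ^ k) := by
  refine ⟨fun i hi => ?_, fun i hi => ?_, hf _ _ ?_ hL.accepted⟩
  · obtain ⟨u, hu, h'⟩ := hL.matched i hi
    exact ⟨u, hu, by rw [rows_div hk, pow_succ, ← Nat.div_div_eq_div_mul, h']⟩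
  · rw [rows_div hk, rows_div hk]
    exact Nat.div_le_div_right (hL.sorted i hi)
  · intro u
    simp only [cand, Finset.mem_filter]
    rintro ⟨hu, i, hi, h'⟩
    exact ⟨hu, i, hi, by rw [rows_div hk, pow_succ, ← Nat.div_div_eq_div_mul, h']⟩

theorem Live.ancestor {f : Finset ℕ → Bool} {n k : ℕ} {key : ℕ → ℕ} {p : ℕ}
    (hf : ∀ X Y, X ⊆ Y → f X = true → f Y = true) (hk : k ≠ 0) (hL : Live f n k key 0 p) (h : ℕ) :
    Live f n k key h (p / (2 ^ k) ^ h) := by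
  induction h with
  | zero => simpa using hL
  | succ h ih =>
    rw [pow_succ, ← Nat.div_div_eq_div_mul]
    exact ih.parent hf hk

open Classical in
/-- The nodes that are the root or have a live parent, as pairs of height and number. -/
noncomputable def frontier (f : Finset ℕ → Bool) (n k : ℕ) (key : ℕ → ℕ) (T : ℕ) :
    Finset (ℕ × ℕ) :=
  (Finset.range (T + 1) ×ˢ Finset.range ((2 ^ k) ^ T)).filter fun x =>
    x.2 < (2 ^ k) ^ (T - x.1) ∧ (x.1 = T ∨ Live f n k key (x.1 + 1) (x.2 / 2 ^ k))

open Classical in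
/-- The sets at the live leaves from position `p` on. -/
noncomputable def leafSets (f : Finset ℕ → Bool) (n k : ℕ) (key : ℕ → ℕ) (T p : ℕ) :
    List (Finset ℕ) :=
  ((List.range' p ((2 ^ k) ^ T - p)).filter fun q => Live f n k key 0 q).map (cand n k key 0)

theorem leafSets_split {f : Finset ℕ → Bool} {n k : ℕ} {key : ℕ → ℕ} {T p p' : ℕ} (h₁ : p ≤ p')
    (h₂ : p' ≤ (2 ^ k) ^ T) (h : ∀ q, p ≤ q → q < p' → ¬ Live f n k key 0 q) :
    leafSets f n k key T p = leafSets f n k key T p' := by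
  classical
  unfold leafSets
  have : (2 ^ k) ^ T - p = (p' - p) + ((2 ^ k) ^ T - p') := by omega
  rw [this, ← List.range'_append_1, List.filter_append, List.filter_eq_nil_iff.2, List.nil_append,
    show p + (p' - p) = p' by omega]
  intro q hq
  have := List.mem_range'_1.1 hq
  simpa using h q this.1 (by omega)

theorem leafSets_cons {f : Finset ℕ → Bool} {n k : ℕ} {key : ℕ → ℕ} {T p : ℕ}
    (h : p < (2 ^ k) ^ T) (hL : Live f n k key 0 p) :
    leafSets f n k key T p = cand n k key 0 p :: leafSets f n k key T (p + 1) := by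
  classical
  unfold leafSets
  have : (2 ^ k) ^ T - p = ((2 ^ k) ^ T - (p + 1)) + 1 := by omega
  rw [this, List.range'_succ, List.filter_cons_of_pos (by simpa using hL), List.map_cons]

/-- A bound for the time of one descent and the operations around it. -/
def descentTime (n k d T : ℕ) : ℕ := (d + 1) * (nodeTime n k d T + n + 10) + 10

theorem descend_regs (D : Option Prog) : (descend D).regs =
    [1, 1, 23, 21, 17, 2, 18, 19, 20, 19, 0, 20, 18, 22, 1, 22, 0, 1, 23, 21, 17, 2, 0, 0, 0,
      16, 14, 15, 16] := by
  cases D <;> rfl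

theorem descend_arrs (D : Option Prog) : (descend D).arrs = [0, 0] := by
  cases D <;> rfl

/-- The potential is the number of frontier nodes whose block of leaves ends after the current
position. Every descent lowers it, so it bounds the number of descents still to come. -/
theorem tri_explore_loop {D : Option Prog} {f : Finset ℕ → Bool} {T : ℕ} {key : ℕ → ℕ} {d : ℕ}
    (hD : AskSpec I O D f T) (hf : ∀ X Y, X ⊆ Y → f X = true → f Y = true) (hk0 : I.k ≠ 0)
    (N : ℕ) : ∀ σ : State, (∀ u < I.n, σ.arr 1 u = key u) → σ.reg 8 = 2 ^ I.k → σ.reg 9 = 2 ^ d →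
      σ.reg 10 = (2 ^ I.k) ^ d →
      ((frontier f I.n I.k key d).filter fun x => σ.reg 13 < (x.2 + 1) * (2 ^ I.k) ^ x.1).card ≤ N →
    Tri I O (.loop (.lt (.reg 13) (.reg 10)) <|
      .seq (.set 14 (.reg 9)) <| .seq (.set 15 (.reg 10)) <| .seq (.set 16 (.lit 1)) <|
      .seq (descend D) <|
      .set 13 (.add (.sub (.reg 13) (.mod (.reg 13) (.reg 15))) (.reg 15))) σ fun τ =>
        τ.time ≤ σ.time + (N * descentTime I.n I.k d T + 1) ∧
        τ.calls ≤ σ.calls + N * (d + 1) ∧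
        τ.out = σ.out ++ leafSets f I.n I.k key d (σ.reg 13) := by
  have hB : 0 < 2 ^ I.k := by positivity
  induction N with
  | zero =>
    intro σ hk h8 h9 h10 hN
    have hge : (2 ^ I.k) ^ d ≤ σ.reg 13 := by
      by_contra hlt
      -- The root is counted until the position passes the last leaf, so potential 0 means that the
      -- traversal is over.
      have : (d, 0) ∈ (frontier f I.n I.k key d).filter
          fun x => σ.reg 13 < (x.2 + 1) * (2 ^ I.k) ^ x.1 := by
        simp [frontier]
        omega
      simp [Finset.card_eq_zero.1 (Nat.le_zero.1 hN)] at this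
    refine Tri.loop_stop (Term.eval_lt_eq_zero (by simp only [Term.eval]; omega)) ?_
    simp [leafSets, Nat.sub_eq_zero_of_le hge]
  | succ N ih =>
    intro σ hk h8 h9 h10 hN
    set p := σ.reg 13 with hp
    by_cases hlt : p < (2 ^ I.k) ^ d
    swap
    · refine Tri.loop_stop (Term.eval_lt_eq_zero (by simp only [Term.eval]; omega)) ?_
      simp [leafSets, Nat.sub_eq_zero_of_le (not_lt.1 hlt)]
    refine Tri.loop_step (Term.eval_lt_ne_zero (by simp only [Term.eval]; omega))
      (Tri.set_seq (Tri.set_seq (Tri.set_seq (Tri.seq ?_))))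
    refine (tri_descend (key := key) hD hk0 hlt d _ (by simpa using hk) (by simpa using h8)
      (by simpa [Term.eval] using h9) (by simpa [Term.eval] using h10) (by simp [hp])
      (by simp [Term.eval])).conseq ?_
    rintro τ hF ⟨ht, hc, h', hh', hlive, h15, hout⟩
    have e13 : τ.reg 13 = p := by simp [hF.reg 13 (by simp [descend_regs]), hp]
    set p' := p - p % (2 ^ I.k) ^ h' + (2 ^ I.k) ^ h' with hp'
    have hpos : 0 < (2 ^ I.k) ^ h' := by positivity
    have hp'' : p' = (p / (2 ^ I.k) ^ h' + 1) * (2 ^ I.k) ^ h' := by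
      have := Nat.div_add_mod p ((2 ^ I.k) ^ h')
      rw [hp', add_mul, one_mul, mul_comm]
      omega
    have hpp' : p < p' := by
      rw [hp'', mul_comm]; exact Nat.lt_mul_div_succ p hpos
    have hm : p / (2 ^ I.k) ^ h' < (2 ^ I.k) ^ (d - h') := by
      rw [Nat.div_lt_iff_lt_mul hpos, ← pow_add, Nat.sub_add_cancel hh']
      exact hlt
    have hp'd : p' ≤ (2 ^ I.k) ^ d := by
      rw [hp'']
      calc _ ≤ (2 ^ I.k) ^ (d - h') * (2 ^ I.k) ^ h' := Nat.mul_le_mul_right _ hm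
        _ = _ := by rw [← pow_add, Nat.sub_add_cancel hh']
    refine Tri.set ?_
    have e13' : Term.eval I τ (.add (.sub (.reg 13) (.mod (.reg 13) (.reg 15))) (.reg 15)) = p' := by
      simp [Term.eval, e13, h15, hp']
    rw [e13']
    refine (ih _ ?_ ?_ ?_ ?_ ?_).conseq ?_
    · simpa [hF.arr 1 (by simp [descend_arrs])] using hk
    · simpa [hF.reg 8 (by simp [descend_regs])] using h8
    · simpa [hF.reg 9 (by simp [descend_regs])] using h9
    · simpa [hF.reg 10 (by simp [descend_regs])] using h10
    · simp only [State.tick_reg, State.setReg_reg, if_true]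
      refine Nat.le_of_lt_succ (lt_of_lt_of_le (Finset.card_lt_card ?_) hN)
      -- The last node of the descent is the root or has a parent that passed the test, hence lies
      -- in the frontier. Its block ends exactly at `p'`, so it is no longer counted.
      refine (Finset.ssubset_iff_of_subset ?_).2 ⟨(h', p / (2 ^ I.k) ^ h'), ?_, ?_⟩
      · intro x
        simp only [Finset.mem_filter]
        rintro ⟨h1, h2⟩
        exact ⟨h1, hpp'.trans h2⟩
      · simp only [Finset.mem_filter, frontier, Finset.mem_product, Finset.mem_range]
        refine ⟨⟨⟨by omega, (Nat.div_le_self _ _).trans_lt hlt⟩, hm, ?_⟩, hp'' ▸ hpp'⟩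
        by_cases hd : h' = d
        · exact .inl hd
        · refine .inr ?_
          have := hlive (h' + 1) (by omega) (by omega)
          rwa [pow_succ, ← Nat.div_div_eq_div_mul] at this
      · simp only [Finset.mem_filter, not_and, not_lt]
        intro _
        exact hp''.ge
    · rintro ρ - ⟨ht', hc', ho'⟩
      simp only [State.tick_time, State.setReg_time, State.tick_calls, State.setReg_calls,
        State.tick_out, State.setReg_out, State.tick_reg, State.setReg_reg, if_true] at *
      refine ⟨?_, ?_, ?_⟩
      · rw [add_mul]; unfold descentTime at *; omega
      · rw [add_mul]; omega
      · rw [ho']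
        rcases hout with ⟨h0, hL, hout⟩ | ⟨hL, hout⟩
        · have : p' = p + 1 := by rw [hp'', h0]; simp
          rw [hout, this, leafSets_cons hlt hL]
          simp
        -- A live leaf in the skipped block would make its ancestor at height `h'` live, and that
        -- ancestor is the node that just failed.
        · rw [hout, leafSets_split hpp'.le hp'd]
          intro q hq hq' hLq
          apply hL
          have := hLq.ancestor hf hk0 h'
          rwa [show q / (2 ^ I.k) ^ h' = p / (2 ^ I.k) ^ h' from ?_] at this
          apply le_antisymm
          · rw [← Nat.lt_succ_iff, Nat.div_lt_iff_lt_mul hpos]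
            exact hp'' ▸ hq'
          · exact Nat.div_le_div_right hq

theorem tri_explore {σ : State} {D : Option Prog} {f : Finset ℕ → Bool} {T : ℕ} {key : ℕ → ℕ}
    {d : ℕ} (hD : AskSpec I O D f T) (hf : ∀ X Y, X ⊆ Y → f X = true → f Y = true) (hk0 : I.k ≠ 0)
    (hk : ∀ u < I.n, σ.arr 1 u = key u) (h8 : σ.reg 8 = 2 ^ I.k) (h9 : σ.reg 9 = 2 ^ d)
    (h10 : σ.reg 10 = (2 ^ I.k) ^ d) :
    Tri I O (explore D) σ fun τ =>
      τ.time ≤ σ.time + ((frontier f I.n I.k key d).card * descentTime I.n I.k d T + 2) ∧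
      τ.calls ≤ σ.calls + (frontier f I.n I.k key d).card * (d + 1) ∧
      τ.out = σ.out ++ leafSets f I.n I.k key d 0 := by
  refine Tri.set_seq ?_
  refine (tri_explore_loop (key := key) hD hf hk0 (frontier f I.n I.k key d).card _
    (by simpa using hk) (by simpa using h8) (by simpa using h9) (by simpa using h10)
    (Finset.card_filter_le _ _)).conseq ?_
  rintro τ - ⟨ht, hc, ho⟩
  simp only [State.tick_time, State.setReg_time] at ht
  refine ⟨by omega, by simpa using hc, by simpa [Term.eval] using ho⟩

/-! ### Nodes as tuples of rows -/

theorem two_le_two_pow {k : ℕ} (hk : k ≠ 0) : 2 ≤ 2 ^ k :=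
  (pow_one 2).symm.le.trans (Nat.pow_le_pow_right (by norm_num) (by omega))

theorem testBit_row {k : ℕ} (hk : k ≠ 0) (t : ℕ) :
    ∀ q, (row (2 ^ k) q).testBit t = q.testBit (k * t) := by
  have hB := two_le_two_pow hk
  induction t with
  | zero =>
    intro q
    by_cases hq : q = 0
    · subst hq; simp [row_zero]
    · rw [row_of_ne_zero hB hq]
      simp [Nat.testBit_zero, Nat.add_mod]
  | succ t ih =>
    intro q
    rw [Nat.testBit_succ, ← row_div hB, ih, Nat.testBit_div_two_pow]
    congr 1

theorem testBit_rows {k : ℕ} (hk : k ≠ 0) (m i t : ℕ) :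
    (rows k m i).testBit t = m.testBit (k * t + i) := by
  rw [rows, testBit_row hk, Nat.testBit_div_two_pow]

/-- The rows share out all binary digits of m: digit j is digit j / k of row j % k. -/
theorem eq_of_rows_eq {k : ℕ} (hk : k ≠ 0) {m m' : ℕ} (h : ∀ i < k, rows k m i = rows k m' i) :
    m = m' := by
  refine Nat.eq_of_testBit_eq fun j => ?_
  have hj : j = k * (j / k) + j % k := (Nat.div_add_mod j k).symm
  rw [hj, ← testBit_rows hk, ← testBit_rows hk, h _ (Nat.mod_lt _ (by omega))]

theorem row_lt {B : ℕ} (hB : 2 ≤ B) (d : ℕ) : ∀ q, q < B ^ d → row B q < 2 ^ d := by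
  induction d with
  | zero =>
    intro q hq
    have : q = 0 := by simpa using hq
    simp [this, row_zero]
  | succ d ih =>
    intro q hq
    by_cases h0 : q = 0
    · simp [h0, row_zero]
    · have := ih (q / B) (by rw [Nat.div_lt_iff_lt_mul (by omega), ← pow_succ]; exact hq)
      rw [row_of_ne_zero hB h0, pow_succ]
      omega

theorem rows_lt {k d m : ℕ} (hk : k ≠ 0) (hm : m < (2 ^ k) ^ d) (i : ℕ) : rows k m i < 2 ^ d :=
  row_lt (two_le_two_pow hk) d _ ((Nat.div_le_self _ _).trans_lt hm)

/-- The map from nodes to tuples is injective, and both sides have 2^(kd) elements. -/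
theorem exists_rows_eq {k d : ℕ} (hk : k ≠ 0) (g : Fin k → ℕ) (hg : ∀ i, g i < 2 ^ d) :
    ∃ m < (2 ^ k) ^ d, ∀ i : Fin k, rows k m i = g i := by
  let F : Fin ((2 ^ k) ^ d) → (Fin k → Fin (2 ^ d)) := fun m i => ⟨rows k m i, rows_lt hk m.2 i⟩
  have hF : Function.Bijective F := by
    rw [Fintype.bijective_iff_injective_and_card]
    constructor
    · intro m m' h
      refine Fin.ext (eq_of_rows_eq hk fun i hi => ?_)
      exact congrArg Fin.val (congrFun h ⟨i, hi⟩)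
    · simp [← pow_mul, mul_comm]
  obtain ⟨m, hm⟩ := hF.2 fun i => ⟨g i, hg i⟩
  exact ⟨m, m.2, fun i => congrArg Fin.val (congrFun hm i)⟩

theorem monotone_of_sorted {k : ℕ} {g : ℕ → ℕ} (h : ∀ i, i + 1 < k → g i ≤ g (i + 1)) :
    Monotone fun i : Fin k => g i := by
  cases k with
  | zero => exact fun i => i.elim0
  | succ k =>
    rw [Fin.monotone_iff_le_succ]
    intro i
    exact h i (by omega)

theorem ora_eq_true {𝒲 : Finset (Finset ℕ)} {X : Finset ℕ} :
    ora 𝒲 X = true ↔ ∃ W ∈ 𝒲, W ⊆ X := by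
  simp [ora]

theorem ora_mono (𝒲 : Finset (Finset ℕ)) (X Y : Finset ℕ) (h : X ⊆ Y) (hX : ora 𝒲 X = true) :
    ora 𝒲 Y = true := by
  rw [ora_eq_true] at *
  obtain ⟨W, hW, h'⟩ := hX
  exact ⟨W, hW, h'.trans h⟩

/-! ### Heights at which truncated keys are distinct. -/

section Injective

variable {𝒲 : Finset (Finset ℕ)} {n k : ℕ} {key : ℕ → ℕ} {h m : ℕ}

theorem card_cand_le (hinj : Set.InjOn (fun u => key u / 2 ^ h) (Finset.range n : Set ℕ)) :
    (cand n k key h m).image (fun u => key u / 2 ^ h) ⊆ (Finset.range k).image (rows k m) ∧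
    ((cand n k key h m).image fun u => key u / 2 ^ h).card = (cand n k key h m).card := by
  constructor
  · intro x hx
    obtain ⟨u, hu, rfl⟩ := Finset.mem_image.1 hx
    obtain ⟨-, i, hi, hi'⟩ := Finset.mem_filter.1 hu
    exact Finset.mem_image.2 ⟨i, Finset.mem_range.2 hi, hi'.symm⟩
  · refine Finset.card_image_of_injOn (hinj.mono ?_)
    exact_mod_cast Finset.filter_subset _ _

/-- Each row is matched by at most one element, so there are at most k candidates. -/
theorem eq_cand {w : Finset ℕ} (hw : w.card = k) (hwc : w ⊆ cand n k key h m)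
    (hinj : Set.InjOn (fun u => key u / 2 ^ h) (Finset.range n : Set ℕ)) :
    w = cand n k key h m := by
  refine Finset.eq_of_subset_of_card_le hwc ?_
  obtain ⟨h₁, h₂⟩ := card_cand_le (k := k) (m := m) hinj
  rw [hw, ← h₂]
  exact (Finset.card_le_card h₁).trans (Finset.card_image_le.trans (by simp))

theorem Live.cand_mem (h𝒲 : 𝒲 ⊆ (Finset.range n).powersetCard k)
    (hinj : Set.InjOn (fun u => key u / 2 ^ h) (Finset.range n : Set ℕ))
    (hL : Live (ora 𝒲) n k key h m) : cand n k key h m ∈ 𝒲 := by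
  obtain ⟨w, hw, hwc⟩ := ora_eq_true.1 hL.accepted
  rwa [← eq_cand (Finset.mem_powersetCard.1 (h𝒲 hw)).2 hwc hinj]

/-- The candidates form a witness, so k distinct truncated keys occur among k rows. The rows are
thus these keys in increasing order, and the candidate set determines the node. -/
theorem Live.strictMono (h𝒲 : 𝒲 ⊆ (Finset.range n).powersetCard k)
    (hinj : Set.InjOn (fun u => key u / 2 ^ h) (Finset.range n : Set ℕ))
    (hL : Live (ora 𝒲) n k key h m) :
    StrictMono (fun i : Fin k => rows k m i) ∧
    Set.range (fun i : Fin k => rows k m i) =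
      (fun u => key u / 2 ^ h) '' (cand n k key h m : Set ℕ) := by
  have hc := (Finset.mem_powersetCard.1 (h𝒲 (hL.cand_mem h𝒲 hinj))).2
  obtain ⟨h₁, h₂⟩ := card_cand_le (k := k) (m := m) hinj
  rw [hc] at h₂
  have h₃ : (cand n k key h m).image (fun u => key u / 2 ^ h) = (Finset.range k).image (rows k m) :=
    Finset.eq_of_subset_of_card_le h₁ (by rw [h₂]; exact Finset.card_image_le.trans (by simp))
  have h₄ : Set.InjOn (rows k m) (Finset.range k : Set ℕ) := by
    rw [← Finset.card_image_iff, ← h₃, h₂, Finset.card_range]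
  constructor
  · refine (monotone_of_sorted hL.sorted).strictMono_of_injective fun i j hij => ?_
    exact Fin.ext (h₄ (by simp) (by simp) hij)
  · have h₅ := congrArg (fun s : Finset ℕ => (s : Set ℕ)) h₃
    simp only [Finset.coe_image] at h₅
    rw [h₅]
    ext x
    constructor
    · rintro ⟨i, rfl⟩
      exact ⟨i, by simp, rfl⟩
    · rintro ⟨i, hi, rfl⟩
      exact ⟨⟨i, by simpa using hi⟩, rfl⟩

theorem Live.eq_of_cand_eq {m' : ℕ} (hk : k ≠ 0) (h𝒲 : 𝒲 ⊆ (Finset.range n).powersetCard k)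
    (hinj : Set.InjOn (fun u => key u / 2 ^ h) (Finset.range n : Set ℕ))
    (hL : Live (ora 𝒲) n k key h m) (hL' : Live (ora 𝒲) n k key h m')
    (heq : cand n k key h m = cand n k key h m') : m = m' := by
  obtain ⟨h₁, h₂⟩ := hL.strictMono h𝒲 hinj
  obtain ⟨h₁', h₂'⟩ := hL'.strictMono h𝒲 hinj
  have := (h₁.range_inj h₁').1 (by rw [h₂, h₂', heq])
  exact eq_of_rows_eq hk fun i hi => congrFun this ⟨i, hi⟩

end Injective

/-- The sets at the live leaves are the witnesses. -/
theorem leafSets_spec {𝒲 : Finset (Finset ℕ)} {n k : ℕ} {key : ℕ → ℕ} {T : ℕ} (hk : k ≠ 0)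
    (h𝒲 : 𝒲 ⊆ (Finset.range n).powersetCard k)
    (hinj : Set.InjOn key (Finset.range n : Set ℕ)) (hlt : ∀ u < n, key u < 2 ^ T) :
    (leafSets (ora 𝒲) n k key T 0).Nodup ∧ (leafSets (ora 𝒲) n k key T 0).toFinset = 𝒲 := by
  classical
  have hinj' : Set.InjOn (fun u => key u / 2 ^ 0) (Finset.range n : Set ℕ) := by simpa using hinj
  constructor
  · refine List.Nodup.map_on ?_ (List.Nodup.filter _ List.nodup_range')
    intro x hx y hy hxy
    have hx := (List.mem_filter.1 hx).2
    have hy := (List.mem_filter.1 hy).2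
    simp only [decide_eq_true_eq] at hx hy
    exact hx.eq_of_cand_eq hk h𝒲 hinj' hy hxy
  · ext w
    simp only [leafSets, List.mem_toFinset, List.mem_map, List.mem_filter, List.mem_range'_1,
      decide_eq_true_eq]
    constructor
    · rintro ⟨m, ⟨-, hm⟩, rfl⟩
      exact hm.cand_mem h𝒲 hinj'
    · intro hw
      obtain ⟨hwn, hwk⟩ := Finset.mem_powersetCard.1 (h𝒲 hw)
      -- The leaf belonging to `w` has as rows the keys of `w` in increasing order.
      have hcard : (w.image key).card = k := by
        rw [Finset.card_image_of_injOn (hinj.mono (by exact_mod_cast hwn)), hwk]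
      have hmem : ∀ i, ∃ u ∈ w, key u = (w.image key).orderEmbOfFin hcard i := fun i =>
        Finset.mem_image.1 (Finset.orderEmbOfFin_mem _ hcard i)
      obtain ⟨m, hm, hrows⟩ := exists_rows_eq (d := T) hk ((w.image key).orderEmbOfFin hcard)
        fun i => by
          obtain ⟨u, hu, hu'⟩ := hmem i
          rw [← hu']
          exact hlt u (Finset.mem_range.1 (hwn hu))
      have hsub : w ⊆ cand n k key 0 m := by
        intro u hu
        refine Finset.mem_filter.2 ⟨hwn hu, ?_⟩
        have : key u ∈ Set.range ((w.image key).orderEmbOfFin hcard) := by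
          rw [Finset.range_orderEmbOfFin]
          exact_mod_cast Finset.mem_image_of_mem key hu
        obtain ⟨i, hi⟩ := this
        exact ⟨i, i.2, by rw [hrows i, hi]; simp⟩
      refine ⟨m, ⟨by omega, ?_⟩, (eq_cand hwk hsub hinj').symm⟩
      refine ⟨fun i hi => ?_, fun i hi => ?_, ora_eq_true.2 ⟨w, hw, hsub⟩⟩
      · obtain ⟨u, hu, hu'⟩ := hmem ⟨i, hi⟩
        exact ⟨u, Finset.mem_range.1 (hwn hu), by rw [hrows ⟨i, hi⟩, ← hu']; simp⟩
      · rw [hrows ⟨i, by omega⟩, hrows ⟨i + 1, hi⟩]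
        exact (OrderEmbedding.monotone _) (by simp [Fin.le_def])

/-! ### Keys -/

section Keys

variable {n L : ℕ} (κ : Fin n → Fin (2 ^ L)) {b : ℕ}

theorem keyOf_of_lt {u : ℕ} (hu : u < n) : keyOf κ b u = κ ⟨u, hu⟩ * 2 ^ b + u := by
  simp [keyOf, hu]

/-- From height b upwards only random bits remain, so truncated keys of different elements are
independent. -/
theorem keyOf_div {u : ℕ} (hn : n ≤ 2 ^ b) (hu : u < n) (e : ℕ) :
    keyOf κ b u / 2 ^ (b + e) = κ ⟨u, hu⟩ / 2 ^ e := by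
  rw [keyOf_of_lt κ hu, pow_add, ← Nat.div_div_eq_div_mul, mul_comm,
    Nat.mul_add_div (by positivity), Nat.div_eq_of_lt (show u < 2 ^ b by omega), add_zero]

/-- The last b bits spell u itself. Distinctness therefore holds for every outcome, which is why the
output is never wrong. -/
theorem keyOf_injOn (hn : n ≤ 2 ^ b) : Set.InjOn (keyOf κ b) (Finset.range n : Set ℕ) := by
  intro u hu v hv h
  have hu : u < n := by simpa using hu
  have hv : v < n := by simpa using hv
  rw [keyOf_of_lt κ hu, keyOf_of_lt κ hv] at h
  have h' := congrArg (· % 2 ^ b) h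
  simp only [Nat.mul_add_mod_self_right] at h'
  rwa [Nat.mod_eq_of_lt (by omega), Nat.mod_eq_of_lt (by omega)] at h'

theorem keyOf_lt (hn : n ≤ 2 ^ b) {u : ℕ} (hu : u < n) : keyOf κ b u < 2 ^ (L + b) := by
  rw [keyOf_of_lt κ hu, pow_add]
  calc _ < (κ ⟨u, hu⟩ : ℕ) * 2 ^ b + 2 ^ b := by omega
    _ = ((κ ⟨u, hu⟩ : ℕ) + 1) * 2 ^ b := by ring
    _ ≤ _ := Nat.mul_le_mul_right _ (κ ⟨u, hu⟩).2

/-- Up to height b all random bits survive truncation. -/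
theorem keyOf_div_injOn (hn : n ≤ 2 ^ b) (hκ : Function.Injective κ) {h : ℕ} (hh : h ≤ b) :
    Set.InjOn (fun u => keyOf κ b u / 2 ^ h) (Finset.range n : Set ℕ) := by
  intro u hu v hv huv
  have hu : u < n := by simpa using hu
  have hv : v < n := by simpa using hv
  have h' := congrArg (· / 2 ^ (b - h)) huv
  simp only [Nat.div_div_eq_div_mul, ← pow_add, Nat.add_sub_cancel' hh] at h'
  have e₁ := keyOf_div κ hn hu 0
  have e₂ := keyOf_div κ hn hv 0
  simp only [add_zero, pow_zero, Nat.div_one] at e₁ e₂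
  rw [e₁, e₂] at h'
  exact congrArg Fin.val (hκ (Fin.ext h'))

end Keys

/-! ### Counting live nodes -/

open Classical in
/-- The live nodes of height `h` and depth `d`. -/
noncomputable def liveNodes (f : Finset ℕ → Bool) (n k : ℕ) (key : ℕ → ℕ) (h d : ℕ) : Finset ℕ :=
  (Finset.range ((2 ^ k) ^ d)).filter (Live f n k key h)

theorem mem_liveNodes {f : Finset ℕ → Bool} {n k : ℕ} {key : ℕ → ℕ} {h d m : ℕ} :
    m ∈ liveNodes f n k key h d ↔ m < (2 ^ k) ^ d ∧ Live f n k key h m := by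
  simp [liveNodes]

/-- A frontier node other than the root is one of the 2^k children of a live node. -/
theorem card_frontier_le (f : Finset ℕ → Bool) (n k : ℕ) (key : ℕ → ℕ) (T : ℕ) :
    (frontier f n k key T).card ≤
      1 + 2 ^ k * ∑ h ∈ Finset.range T, (liveNodes f n k key (h + 1) (T - (h + 1))).card := by
  classical
  have hB : 0 < 2 ^ k := by positivity
  let S : Finset (ℕ × ℕ) := {(T, 0)}
  let R : ℕ → Finset (ℕ × ℕ) := fun h =>
    ((liveNodes f n k key (h + 1) (T - (h + 1))) ×ˢ Finset.range (2 ^ k)).image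
      fun y => (h, 2 ^ k * y.1 + y.2)
  have hsub : frontier f n k key T ⊆ S ∪ (Finset.range T).biUnion R := by
    rintro ⟨h, m⟩ hx
    simp only [frontier, Finset.mem_filter, Finset.mem_product, Finset.mem_range] at hx
    obtain ⟨⟨hT, -⟩, hm, hL⟩ := hx
    rw [Finset.mem_union]
    by_cases hh : h = T
    · left
      subst hh
      have : m = 0 := by simpa using hm
      simp [S, this]
    · right
      rcases hL with hL | hL
      · exact absurd hL hh
      refine Finset.mem_biUnion.2 ⟨h, Finset.mem_range.2 (by omega), ?_⟩
      refine Finset.mem_image.2 ⟨(m / 2 ^ k, m % 2 ^ k), ?_, ?_⟩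
      · simp only [Finset.mem_product, liveNodes, Finset.mem_filter, Finset.mem_range]
        refine ⟨⟨?_, hL⟩, Nat.mod_lt _ hB⟩
        rw [Nat.div_lt_iff_lt_mul hB, ← pow_succ, show T - (h + 1) + 1 = T - h by omega]
        exact hm
      · simp [Nat.div_add_mod]
  refine (Finset.card_le_card hsub).trans ((Finset.card_union_le _ _).trans ?_)
  rw [Finset.mul_sum]
  refine Nat.add_le_add (by simp [S]) (Finset.card_biUnion_le.trans (Finset.sum_le_sum fun h _ => ?_))
  refine Finset.card_image_le.trans ?_
  rw [Finset.card_product, Finset.card_range, mul_comm]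

theorem card_liveNodes_le_card {𝒲 : Finset (Finset ℕ)} {n k : ℕ} {key : ℕ → ℕ} {h : ℕ} (hk : k ≠ 0)
    (h𝒲 : 𝒲 ⊆ (Finset.range n).powersetCard k)
    (hinj : Set.InjOn (fun u => key u / 2 ^ h) (Finset.range n : Set ℕ)) (d : ℕ) :
    (liveNodes (ora 𝒲) n k key h d).card ≤ 𝒲.card := by
  refine Finset.card_le_card_of_injOn (cand n k key h) ?_ ?_
  · intro m hm
    exact (mem_liveNodes.1 hm).2.cand_mem h𝒲 hinj
  · intro m hm m' hm' heq
    exact (mem_liveNodes.1 hm).2.eq_of_cand_eq hk h𝒲 hinj (mem_liveNodes.1 hm').2 heq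

/-- A choice of one matching element per row determines the rows. This crude bound is needed only
when random parts collide. -/
theorem card_liveNodes_le_pow {f : Finset ℕ → Bool} {n k : ℕ} (hk : k ≠ 0) (key : ℕ → ℕ) (h d : ℕ) :
    (liveNodes f n k key h d).card ≤ n ^ k := by
  classical
  have key' : ∀ m : liveNodes f n k key h d, ∃ g : Fin k → Fin n,
      ∀ i : Fin k, key (g i) / 2 ^ h = rows k m i := by
    intro m
    choose u hu hu' using fun i : Fin k => (mem_liveNodes.1 m.2).2.matched i i.2
    exact ⟨fun i => ⟨u i, hu i⟩, hu'⟩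
  choose g hg using key'
  have hinj : Function.Injective g := fun m m' heq => by
    refine Subtype.ext (eq_of_rows_eq hk fun i hi => ?_)
    rw [← hg m ⟨i, hi⟩, ← hg m' ⟨i, hi⟩, heq]
  simpa using Fintype.card_le_of_injective g hinj

/-- The number of functions that map `w` into `A`. -/
theorem card_maps_into {n M : ℕ} (w : Finset (Fin n)) (A : Finset (Fin M)) :
    (Finset.univ.filter fun κ : Fin n → Fin M => ∀ u ∈ w, κ u ∈ A).card * M ^ w.card =
      A.card ^ w.card * M ^ n := by
  have h : (Finset.univ.filter fun κ : Fin n → Fin M => ∀ u ∈ w, κ u ∈ A) =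
      Fintype.piFinset fun u => if u ∈ w then A else Finset.univ := by
    ext κ
    simp only [Finset.mem_filter, Finset.mem_univ, true_and, Fintype.mem_piFinset]
    refine forall_congr' fun u => ?_
    by_cases hu : u ∈ w <;> simp [hu]
  rw [h, Fintype.card_piFinset]
  have h' : ∀ u, (if u ∈ w then A else Finset.univ).card = if u ∈ w then A.card else M := by
    intro u
    split <;> simp
  simp only [h']
  rw [Finset.prod_ite]
  simp only [Finset.prod_const, Finset.filter_univ_mem]
  have hc : (Finset.univ.filter fun u => u ∉ w).card + w.card = n := by
    have := Finset.card_filter_add_card_filter_not (s := (Finset.univ : Finset (Fin n))) (· ∈ w)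
    simp only [Finset.filter_univ_mem, Finset.card_univ, Fintype.card_fin] at this
    omega
  rw [mul_assoc, ← pow_add, hc]

/-- Union bound over pairs u ≠ v and their M possible common values, each combination having
probability M^(-2). -/
theorem card_not_injective_le (n M : ℕ) :
    (Finset.univ.filter fun κ : Fin n → Fin M => ¬ Function.Injective κ).card * M ≤
      n ^ 2 * M ^ n := by
  classical
  rcases Nat.eq_zero_or_pos M with rfl | hM
  · simp
  have hsub : (Finset.univ.filter fun κ : Fin n → Fin M => ¬ Function.Injective κ) ⊆
      (Finset.univ.filter fun p : Fin n × Fin n => p.1 ≠ p.2).biUnion fun p =>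
        Finset.univ.biUnion fun c : Fin M =>
          Finset.univ.filter fun κ : Fin n → Fin M => ∀ u ∈ ({p.1, p.2} : Finset (Fin n)),
            κ u ∈ ({c} : Finset (Fin M)) := by
    intro κ hκ
    simp only [Finset.mem_filter, Finset.mem_univ, true_and, Function.Injective, not_forall] at hκ
    obtain ⟨u, v, h, huv⟩ := hκ
    simp only [Finset.mem_biUnion, Finset.mem_filter, Finset.mem_univ, true_and]
    exact ⟨(u, v), huv, κ u, by simp [h]⟩
  have hp : ∀ p ∈ (Finset.univ.filter fun p : Fin n × Fin n => p.1 ≠ p.2),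
      (Finset.univ.biUnion fun c : Fin M =>
          Finset.univ.filter fun κ : Fin n → Fin M => ∀ u ∈ ({p.1, p.2} : Finset (Fin n)),
            κ u ∈ ({c} : Finset (Fin M))).card * M ≤ M ^ n := by
    intro p hp
    have hp : p.1 ≠ p.2 := (Finset.mem_filter.1 hp).2
    have h₁ : ∀ c : Fin M, (Finset.univ.filter fun κ : Fin n → Fin M =>
        ∀ u ∈ ({p.1, p.2} : Finset (Fin n)), κ u ∈ ({c} : Finset (Fin M))).card * M ^ 2 = M ^ n := by
      intro c
      have := card_maps_into ({p.1, p.2} : Finset (Fin n)) {c}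
      rw [Finset.card_pair hp] at this
      simpa using this
    refine Nat.le_of_mul_le_mul_right ?_ hM
    calc _ ≤ (∑ c : Fin M, (Finset.univ.filter fun κ : Fin n → Fin M =>
        ∀ u ∈ ({p.1, p.2} : Finset (Fin n)), κ u ∈ ({c} : Finset (Fin M))).card) * M * M := by
          gcongr
          exact Finset.card_biUnion_le
      _ = ∑ c : Fin M, M ^ n := by
          rw [mul_assoc, ← sq, Finset.sum_mul]
          exact Finset.sum_congr rfl fun c _ => h₁ c
      _ = _ := by simp [mul_comm]
  calc _ ≤ (∑ p ∈ (Finset.univ.filter fun p : Fin n × Fin n => p.1 ≠ p.2),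
        (Finset.univ.biUnion fun c : Fin M =>
          Finset.univ.filter fun κ : Fin n → Fin M => ∀ u ∈ ({p.1, p.2} : Finset (Fin n)),
            κ u ∈ ({c} : Finset (Fin M))).card) * M :=
        Nat.mul_le_mul_right _ ((Finset.card_le_card hsub).trans Finset.card_biUnion_le)
    _ ≤ ∑ p ∈ (Finset.univ.filter fun p : Fin n × Fin n => p.1 ≠ p.2), M ^ n := by
        rw [Finset.sum_mul]
        exact Finset.sum_le_sum hp
    _ ≤ ∑ p : Fin n × Fin n, M ^ n := Finset.sum_le_sum_of_subset (Finset.filter_subset _ _)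
    _ = _ := by simp [sq]

/-- (k+1)^k ≤ (k+1)(k+2)⋯(2k) = k! · C(2k,k), and C(2k,k) ≤ 4^k. -/
theorem pow_self_le_factorial (k : ℕ) : k ^ k ≤ 4 ^ k * k.factorial :=
  calc k ^ k ≤ (k + 1) ^ k := Nat.pow_le_pow_left (by omega) _
    _ ≤ (k + 1).ascFactorial k := Nat.pow_succ_le_ascFactorial _ _
    _ = k.factorial * (k + k).choose k := Nat.ascFactorial_eq_factorial_mul_choose _ _
    _ ≤ k.factorial * 2 ^ (k + k) := Nat.mul_le_mul_left _ (Nat.choose_le_two_pow _ _)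
    _ = 4 ^ k * k.factorial := by rw [← two_mul, pow_mul]; norm_num [mul_comm]

/-- Divided by D^k, the left side bounds the expected number of nondecreasing k-tuples that absorb a
fixed witness. For D ≤ k the binomial is at most 2^(3k). For k ≤ D, replace k^k by 4^k k!, which
turns the binomial into a falling factorial of at most (2D)^k. -/
theorem choose_mul_min_pow_le (k D : ℕ) :
    (D + k - 1).choose k * (min k D) ^ k ≤ 8 ^ k * D ^ k := by
  rcases le_total D k with h | h
  · rw [min_eq_right h]
    refine Nat.mul_le_mul_right _ ((Nat.choose_le_two_pow _ _).trans ?_)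
    calc 2 ^ (D + k - 1) ≤ 2 ^ (3 * k) := Nat.pow_le_pow_right (by norm_num) (by omega)
      _ = 8 ^ k := by rw [pow_mul]; norm_num
  · rw [min_eq_left h]
    calc (D + k - 1).choose k * k ^ k ≤ (D + k - 1).choose k * (4 ^ k * k.factorial) :=
          Nat.mul_le_mul_left _ (pow_self_le_factorial k)
      _ = 4 ^ k * (D + k - 1).descFactorial k := by
          rw [Nat.descFactorial_eq_factorial_mul_choose]; ring
      _ ≤ 4 ^ k * (2 * D) ^ k := by
          gcongr
          exact (Nat.descFactorial_le_pow _ _).trans (Nat.pow_le_pow_left (by omega) _)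
      _ = 8 ^ k * D ^ k := by rw [← mul_pow, ← mul_pow]; congr 1; ring

open Classical in
/-- The number of nodes with nondecreasing rows. -/
theorem card_sorted_le {k : ℕ} (hk : k ≠ 0) (d : ℕ) :
    ((Finset.range ((2 ^ k) ^ d)).filter fun m =>
      ∀ i, i + 1 < k → rows k m i ≤ rows k m (i + 1)).card ≤ (2 ^ d + k - 1).choose k := by
  -- Stars and bars: adding i to row i turns nondecreasing tuples into strictly increasing ones,
  -- hence into k-subsets of a range of size 2^d + k - 1.
  have hmono : ∀ m, (∀ i, i + 1 < k → rows k m i ≤ rows k m (i + 1)) →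
      StrictMono fun i : Fin k => rows k m i + i := by
    intro m hm i j hij
    have := monotone_of_sorted hm hij.le
    simp only at this ⊢
    have : (i : ℕ) < j := hij
    omega
  rw [← Finset.card_range (2 ^ d + k - 1), ← Finset.card_powersetCard]
  refine Finset.card_le_card_of_injOn
    (fun m => Finset.univ.image fun i : Fin k => rows k m i + i) ?_ ?_
  · intro m hm
    obtain ⟨hm, hs⟩ := Finset.mem_filter.1 hm
    rw [Finset.mem_coe, Finset.mem_powersetCard]
    constructor
    · intro x hx
      obtain ⟨i, -, rfl⟩ := Finset.mem_image.1 hx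
      have := rows_lt hk (Finset.mem_range.1 hm) i
      have := i.2
      rw [Finset.mem_range]
      omega
    · rw [Finset.card_image_of_injective _ (hmono m hs).injective]
      simp
  · intro m hm m' hm' heq
    have hs := hmono m (Finset.mem_filter.1 hm).2
    have hs' := hmono m' (Finset.mem_filter.1 hm').2
    have hr := congrArg (fun s : Finset ℕ => (s : Set ℕ)) heq
    simp only [Finset.coe_image, Finset.coe_univ, Set.image_univ] at hr
    have := (hs.range_inj hs').1 hr
    refine eq_of_rows_eq hk fun i hi => ?_
    have := congrFun this ⟨i, hi⟩
    simpa using this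

/-- At the heights where only random bits of the keys matter, the average number of live nodes is
small. -/
theorem sum_card_liveNodes_le {𝒲 : Finset (Finset ℕ)} {n k b L e : ℕ} (hk : k ≠ 0)
    (h𝒲 : 𝒲 ⊆ (Finset.range n).powersetCard k) (hn : n ≤ 2 ^ b) (he : e ≤ L) :
    ∑ κ : Fin n → Fin (2 ^ L), (liveNodes (ora 𝒲) n k (keyOf κ b) (b + e) (L - e)).card ≤
      𝒲.card * 8 ^ k * (2 ^ L) ^ n := by
  classical
  set D := 2 ^ (L - e) with hD
  have hDe : D * 2 ^ e = 2 ^ L := by rw [hD, ← pow_add, Nat.sub_add_cancel he]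
  let M : Finset ℕ := (Finset.range ((2 ^ k) ^ (L - e))).filter fun m =>
    ∀ i, i + 1 < k → rows k m i ≤ rows k m (i + 1)
  let A : ℕ → Finset (Fin (2 ^ L)) := fun m =>
    Finset.univ.filter fun v => (v : ℕ) / 2 ^ e ∈ (Finset.range k).image (rows k m)
  let w' : Finset ℕ → Finset (Fin n) := fun w => Finset.univ.filter fun u => (u : ℕ) ∈ w
  let good : Finset ℕ → ℕ → (Fin n → Fin (2 ^ L)) → Prop := fun w m κ => ∀ u ∈ w' w, κ u ∈ A m
  -- The candidates of a live node contain a witness `w`, so the random parts of all elements of `w`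
  -- lie in `A m`. This prepares a union bound over `w` and `m`.
  have hlive : ∀ κ : Fin n → Fin (2 ^ L),
      (liveNodes (ora 𝒲) n k (keyOf κ b) (b + e) (L - e)).card ≤
        ∑ w ∈ 𝒲, ∑ m ∈ M, if good w m κ then 1 else 0 := by
    intro κ
    have hsub : liveNodes (ora 𝒲) n k (keyOf κ b) (b + e) (L - e) ⊆
        𝒲.biUnion fun w => M.filter fun m => good w m κ := by
      intro m hm
      obtain ⟨hm, hL⟩ := mem_liveNodes.1 hm
      obtain ⟨w, hw, hwc⟩ := ora_eq_true.1 hL.accepted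
      refine Finset.mem_biUnion.2 ⟨w, hw, Finset.mem_filter.2
        ⟨Finset.mem_filter.2 ⟨Finset.mem_range.2 hm, hL.sorted⟩, fun u hu => ?_⟩⟩
      obtain ⟨-, i, hi, hi'⟩ := Finset.mem_filter.1 (hwc (Finset.mem_filter.1 hu).2)
      rw [keyOf_div κ hn u.2] at hi'
      exact Finset.mem_filter.2 ⟨Finset.mem_univ _, Finset.mem_image.2
        ⟨i, Finset.mem_range.2 hi, hi'.symm⟩⟩
    refine (Finset.card_le_card hsub).trans (Finset.card_biUnion_le.trans (le_of_eq ?_))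
    exact Finset.sum_congr rfl fun w _ => Finset.card_filter _ _
  -- There are at most k distinct rows and at most `D` possible values, and each value extends to
  -- 2^e random parts.
  have hA : ∀ m ∈ M, (A m).card ≤ min k D * 2 ^ e := by
    intro m hm
    have hR : ((Finset.range k).image (rows k m)).card ≤ min k D := by
      refine le_min (Finset.card_image_le.trans (by simp)) ?_
      rw [← Finset.card_range D]
      refine Finset.card_le_card fun x hx => ?_
      obtain ⟨i, -, rfl⟩ := Finset.mem_image.1 hx
      exact Finset.mem_range.2 (rows_lt hk (Finset.mem_range.1 (Finset.mem_filter.1 hm).1) i)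
    refine le_trans ?_ (Nat.mul_le_mul_right _ hR)
    rw [← Finset.card_range (2 ^ e), ← Finset.card_product]
    refine Finset.card_le_card_of_injOn (fun v => ((v : ℕ) / 2 ^ e, (v : ℕ) % 2 ^ e)) ?_ ?_
    · intro v hv
      rw [Finset.mem_coe, Finset.mem_product]
      exact ⟨(Finset.mem_filter.1 hv).2, Finset.mem_range.2 (Nat.mod_lt _ (by positivity))⟩
    · intro v _ v' _ h
      obtain ⟨h₁, h₂⟩ := Prod.mk.inj h
      apply Fin.ext
      rw [← Nat.div_add_mod (v : ℕ) (2 ^ e), ← Nat.div_add_mod (v' : ℕ) (2 ^ e), h₁, h₂]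
  have hcount : ∀ w ∈ 𝒲, ∀ m ∈ M,
      (∑ κ : Fin n → Fin (2 ^ L), if good w m κ then 1 else 0) * (2 ^ L) ^ k ≤
        (min k D * 2 ^ e) ^ k * (2 ^ L) ^ n := by
    intro w hw m hm
    obtain ⟨hwn, hwk⟩ := Finset.mem_powersetCard.1 (h𝒲 hw)
    have hw' : (w' w).card = k := by
      rw [← hwk]
      refine Finset.card_bij (fun u _ => (u : ℕ)) (fun u hu => (Finset.mem_filter.1 hu).2)
        (fun u _ v _ h => Fin.ext h) fun u hu => ?_
      exact ⟨⟨u, Finset.mem_range.1 (hwn hu)⟩, by simpa [w'] using hu, rfl⟩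
    have := card_maps_into (w' w) (A m)
    rw [hw'] at this
    rw [← Finset.card_filter, this]
    exact Nat.mul_le_mul_right _ (Nat.pow_le_pow_left (hA m hm) _)
  refine Nat.le_of_mul_le_mul_right (c := (2 ^ L) ^ k) ?_ (by positivity)
  calc _ ≤ (∑ κ : Fin n → Fin (2 ^ L), ∑ w ∈ 𝒲, ∑ m ∈ M, if good w m κ then 1 else 0) *
        (2 ^ L) ^ k := Nat.mul_le_mul_right _ (Finset.sum_le_sum fun κ _ => hlive κ)
    _ = ∑ w ∈ 𝒲, ∑ m ∈ M, (∑ κ : Fin n → Fin (2 ^ L), if good w m κ then 1 else 0) *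
        (2 ^ L) ^ k := by
        rw [Finset.sum_comm, Finset.sum_mul]
        refine Finset.sum_congr rfl fun w _ => ?_
        rw [Finset.sum_comm, Finset.sum_mul]
    _ ≤ ∑ w ∈ 𝒲, ∑ m ∈ M, (min k D * 2 ^ e) ^ k * (2 ^ L) ^ n :=
        Finset.sum_le_sum fun w hw => Finset.sum_le_sum fun m hm => hcount w hw m hm
    _ = 𝒲.card * (M.card * min k D ^ k) * (2 ^ e) ^ k * (2 ^ L) ^ n := by
        simp only [Finset.sum_const, smul_eq_mul, mul_pow]
        ring
    _ ≤ 𝒲.card * (8 ^ k * D ^ k) * (2 ^ e) ^ k * (2 ^ L) ^ n := by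
        refine Nat.mul_le_mul_right _ (Nat.mul_le_mul_right _ (Nat.mul_le_mul_left _ ?_))
        exact (Nat.mul_le_mul_right _ (card_sorted_le hk _)).trans (choose_mul_min_pow_le k D)
    _ = _ := by
        rw [← hDe, mul_pow D]
        ring

/-- The average number of nodes that are tested. -/
theorem sum_card_frontier_le {𝒲 : Finset (Finset ℕ)} {n k b : ℕ} (hk : k ≠ 0)
    (h𝒲 : 𝒲 ⊆ (Finset.range n).powersetCard k) (h0 : 𝒲.Nonempty) (hn : n ≤ 2 ^ b) :
    ∑ κ : Fin n → Fin (2 ^ ((k + 2) * b)),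
        (frontier (ora 𝒲) n k (keyOf κ b) ((k + 3) * b)).card ≤
      (1 + 2 ^ k * ((k + 3) * b * (𝒲.card * 8 ^ k))) *
        Fintype.card (Fin n → Fin (2 ^ ((k + 2) * b))) := by
  classical
  set L := (k + 2) * b with hL
  have hT : (k + 3) * b = L + b := by rw [hL]; ring
  have hΩ : Fintype.card (Fin n → Fin (2 ^ L)) = (2 ^ L) ^ n := by simp
  rw [hΩ, hT]
  have h𝒲1 : 1 ≤ 𝒲.card := h0.card_pos
  have hlevel : ∀ h ∈ Finset.range (L + b),
      ∑ κ : Fin n → Fin (2 ^ L),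
        (liveNodes (ora 𝒲) n k (keyOf κ b) (h + 1) (L + b - (h + 1))).card ≤
      𝒲.card * 8 ^ k * (2 ^ L) ^ n := by
    intro h hh
    have hh := Finset.mem_range.1 hh
    -- From height b on, the averaging bound applies; up to height b, injectivity of the random
    -- parts decides.
    rcases le_total b (h + 1) with hb | hb
    · obtain ⟨e, he⟩ : ∃ e, h + 1 = b + e := ⟨h + 1 - b, by omega⟩
      have := sum_card_liveNodes_le (L := L) (e := e) hk h𝒲 hn (by omega)
      rwa [he, show L + b - (b + e) = L - e by omega]
    · have h1 : ∀ κ : Fin n → Fin (2 ^ L),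
          (liveNodes (ora 𝒲) n k (keyOf κ b) (h + 1) (L + b - (h + 1))).card ≤
          𝒲.card + n ^ k * if ¬ Function.Injective κ then 1 else 0 := by
        intro κ
        by_cases hκ : Function.Injective κ
        · simpa [hκ] using card_liveNodes_le_card hk h𝒲 (keyOf_div_injOn κ hn hκ hb) _
        · simp only [hκ, not_false_eq_true, if_true, mul_one]
          exact (card_liveNodes_le_pow hk _ _ _).trans (by omega)
      -- The length L = (k+2)b is chosen for this: n^k nodes times collision probability n²/2^L is
      -- at most 1. The extra 1 is absorbed by N + 1 ≤ 2N ≤ 8^k N.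
      have h2 : n ^ k * (Finset.univ.filter fun κ : Fin n → Fin (2 ^ L) =>
          ¬ Function.Injective κ).card ≤ (2 ^ L) ^ n := by
        refine Nat.le_of_mul_le_mul_right (c := 2 ^ L) ?_ (by positivity)
        calc _ = n ^ k * ((Finset.univ.filter fun κ : Fin n → Fin (2 ^ L) =>
              ¬ Function.Injective κ).card * 2 ^ L) := by ring
          _ ≤ n ^ k * (n ^ 2 * (2 ^ L) ^ n) :=
              Nat.mul_le_mul_left _ (card_not_injective_le n (2 ^ L))
          _ = n ^ (k + 2) * (2 ^ L) ^ n := by ring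
          _ ≤ (2 ^ b) ^ (k + 2) * (2 ^ L) ^ n := by gcongr
          _ = _ := by rw [← pow_mul, mul_comm b, ← hL, mul_comm]
      have h8 : 2 ≤ 8 ^ k :=
        (two_le_two_pow hk).trans (Nat.pow_le_pow_left (by norm_num) _)
      calc _ ≤ ∑ κ : Fin n → Fin (2 ^ L),
            (𝒲.card + n ^ k * if ¬ Function.Injective κ then 1 else 0) :=
            Finset.sum_le_sum fun κ _ => h1 κ
        _ = 𝒲.card * (2 ^ L) ^ n + n ^ k * (Finset.univ.filter fun κ : Fin n → Fin (2 ^ L) =>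
          ¬ Function.Injective κ).card := by
            rw [Finset.sum_add_distrib, ← Finset.mul_sum, Finset.card_filter]
            simp [mul_comm]
        _ ≤ 𝒲.card * (2 ^ L) ^ n + 1 * (2 ^ L) ^ n := by
            rw [one_mul]; exact Nat.add_le_add_left h2 _
        _ ≤ 𝒲.card * (2 ^ L) ^ n + 𝒲.card * (2 ^ L) ^ n := by gcongr
        _ = 𝒲.card * 2 * (2 ^ L) ^ n := by ring
        _ ≤ _ := by gcongr
  calc _ ≤ ∑ κ : Fin n → Fin (2 ^ L), (1 + 2 ^ k * ∑ h ∈ Finset.range (L + b),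
          (liveNodes (ora 𝒲) n k (keyOf κ b) (h + 1) (L + b - (h + 1))).card) :=
        Finset.sum_le_sum fun κ _ => card_frontier_le _ _ _ _ _
    _ = (2 ^ L) ^ n + 2 ^ k * ∑ h ∈ Finset.range (L + b), ∑ κ : Fin n → Fin (2 ^ L),
          (liveNodes (ora 𝒲) n k (keyOf κ b) (h + 1) (L + b - (h + 1))).card := by
        rw [Finset.sum_add_distrib, ← Finset.mul_sum, Finset.sum_comm]
        simp
    _ ≤ (2 ^ L) ^ n + 2 ^ k * ∑ h ∈ Finset.range (L + b), 𝒲.card * 8 ^ k * (2 ^ L) ^ n := by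
        gcongr with h hh
        exact hlevel h hh
    _ = _ := by
        simp only [Finset.sum_const, Finset.card_range, smul_eq_mul]
        ring

/-! ### The whole algorithm -/

/-- A bound for the time that is not spent on descents. -/
def overhead (n k T : ℕ) : ℕ :=
  5 * n + T + 20 * (k + 3) ^ 2 * width n +
    n * ((k + 2) * width n * 4 + width n * 3 + 8) + 20

open Classical in
/-- A bound for the number of descents. -/
noncomputable def descents (𝒲 : Finset (Finset ℕ)) (n k : ℕ)
    (κ : Fin n → Fin (2 ^ ((k + 2) * width n))) : ℕ :=
  if 𝒲.Nonempty ∧ k ≠ 0 ∧ 2 ≤ n then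
    (frontier (ora 𝒲) n k (keyOf κ (width n)) ((k + 3) * width n)).card else 0

theorem nodup_toFinset_singleton {𝒲 : Finset (Finset ℕ)} {s : Finset ℕ} (h0 : 𝒲.Nonempty)
    (h : ∀ w ∈ 𝒲, w = s) : [s].Nodup ∧ [s].toFinset = 𝒲 := by
  refine ⟨by simp, ?_⟩
  rw [Finset.eq_singleton_iff_nonempty_unique_mem.2 ⟨h0, h⟩]
  simp

/-- The keys are the only randomness, so all bounds hold outcome by outcome, with `descents` as the
one random quantity left to average. -/
theorem rTri_enumAlg {D : Option Prog} {T : ℕ} {𝒲 : Finset (Finset ℕ)}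
    (hD : AskSpec I O D (ora 𝒲) T) (h𝒲 : 𝒲 ⊆ (Finset.range I.n).powersetCard I.k) :
    RTri I O (Fin I.n → Fin (2 ^ ((I.k + 2) * width I.n))) (enumAlg D) State.init fun κ τ =>
      (τ.out.Nodup ∧ τ.out.toFinset = 𝒲) ∧
      τ.calls ≤ 1 + descents 𝒲 I.n I.k κ * ((I.k + 3) * width I.n + 1) ∧
      τ.time ≤ overhead I.n I.k T +
        descents 𝒲 I.n I.k κ * descentTime I.n I.k ((I.k + 3) * width I.n) T := by
  refine RTri.tri_seq ((tri_fill 1).conseq ?_)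
  rintro τ₁ hF₁ ⟨ht₁, hX⟩
  refine RTri.tri_seq ((hD _ _ _).conseq ?_)
  rintro τ₂ hF₂ ⟨ht₂, h0, hc₂⟩
  have hsub₁ : τ₁.subset I.n 0 = Finset.range I.n := by
    refine Finset.filter_true_of_mem fun u hu => ?_
    rw [hX u (Finset.mem_range.1 hu)]
    norm_num
  have hans : ora 𝒲 (Finset.range I.n) = true ↔ 𝒲.Nonempty := by
    rw [ora_eq_true]
    constructor
    · rintro ⟨w, hw, -⟩; exact ⟨w, hw⟩
    · rintro ⟨w, hw⟩; exact ⟨w, hw, (Finset.mem_powersetCard.1 (h𝒲 hw)).1⟩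
  rw [hsub₁] at h0
  have ec₁ : τ₁.calls = 0 := hF₁.calls (by decide)
  have et₀ : State.init.time = 0 := rfl
  have eo₂ : τ₂.out = [] := by
    rw [hF₂.out (by simp), hF₁.out (by decide)]; rfl
  have hsub₂ : ∀ t a, (τ₂.tick t).subset I.n a = τ₁.subset I.n a := by
    intro t a
    simp only [State.subset, State.tick_arr, hF₂.arr a (by simp)]
  refine RTri.cond (fun hb => RTri.cond (fun hb' => ?_) (fun hb' => RTri.cond (fun hb'' => ?_)
    (fun hb'' => ?_))) (fun hb => ?_)
  · have hne : 𝒲.Nonempty := by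
      rw [← hans]; by_contra h; simp [Term.eval, h0, h] at hb
    have hk : I.k = 0 := by by_contra h; simp [Term.eval, h] at hb'
    refine Tri.to_rTri (Tri.emit fun κ => ⟨?_, ?_, ?_⟩)
    · have h2 : ((τ₂.tick 1).tick 1).subset I.n 2 = ∅ := by
        refine (hsub₂ 2 2).trans (Finset.filter_false_of_mem fun u _ => ?_)
        simp [hF₁.arr 2 (by decide), State.init]
      simp only [State.tick_out, eo₂, List.nil_append, h2]
      refine nodup_toFinset_singleton hne fun w hw => ?_
      simpa [hk] using (Finset.mem_powersetCard.1 (h𝒲 hw)).2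
    · simp only [State.tick_calls]; omega
    · simp only [State.tick_time, overhead]; omega
  · have hne : 𝒲.Nonempty := by
      rw [← hans]; by_contra h; simp [Term.eval, h0, h] at hb
    have hk : I.k ≠ 0 := by intro h; simp [Term.eval, h] at hb'
    have hn : I.n < 2 := by by_contra h; simp [Term.eval, h] at hb''
    refine Tri.to_rTri (Tri.emit fun κ => ⟨?_, ?_, ?_⟩)
    · have h2 : (((τ₂.tick 1).tick 1).tick 1).subset I.n 0 = Finset.range I.n :=
        (hsub₂ 3 0).trans hsub₁
      simp only [State.tick_out, eo₂, List.nil_append, h2]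
      refine nodup_toFinset_singleton hne fun w hw => ?_
      obtain ⟨h₁, h₂⟩ := Finset.mem_powersetCard.1 (h𝒲 hw)
      refine Finset.eq_of_subset_of_card_le h₁ ?_
      rw [Finset.card_range]; omega
    · simp only [State.tick_calls]; omega
    · simp only [State.tick_time, overhead]; omega
  · have hne : 𝒲.Nonempty := by
      rw [← hans]; by_contra h; simp [Term.eval, h0, h] at hb
    have hk : I.k ≠ 0 := by intro h; simp [Term.eval, h] at hb'
    have hn : 2 ≤ I.n := by by_contra h; simp [Term.eval] at hb''; omega
    have hnb : I.n ≤ 2 ^ width I.n := (Nat.lt_pow_succ_log_self (by norm_num) _).le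
    refine RTri.tri_seq ((tri_setup (by omega)).conseq ?_)
    rintro τ₃ hF₃ ⟨ht₃, h4, h5, h8, h9, h10⟩
    refine RTri.seq_tri ((rTri_drawKeys h5 h4).conseq ?_)
    rintro κ τ₄ hF₄ ⟨ht₄, hκ⟩
    refine (tri_explore (d := (I.k + 3) * width I.n) hD (ora_mono 𝒲) hk hκ ?_ ?_ ?_).conseq ?_
    · rw [hF₄.reg 8 (by decide), h8]
    · rw [hF₄.reg 9 (by decide), h9]
    · rw [hF₄.reg 10 (by decide), h10]
    rintro τ₅ - ⟨ht₅, hc₅, ho₅⟩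
    have hdesc : descents 𝒲 I.n I.k κ = (frontier (ora 𝒲) I.n I.k (keyOf κ (width I.n))
        ((I.k + 3) * width I.n)).card := if_pos ⟨hne, hk, hn⟩
    have eo₄ : τ₄.out = [] := by
      rw [hF₄.out (by decide), hF₃.out (by decide)]; exact eo₂
    have ec₄ : τ₄.calls = τ₂.calls := by
      rw [hF₄.calls (by decide), hF₃.calls (by decide)]; rfl
    rw [hdesc]
    refine ⟨?_, by omega, ?_⟩
    · rw [ho₅, eo₄, List.nil_append]
      refine leafSets_spec hk h𝒲 (keyOf_injOn κ hnb) fun u hu => ?_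
      have := keyOf_lt κ hnb hu
      rwa [show (I.k + 2) * width I.n + width I.n = (I.k + 3) * width I.n by ring] at this
    · simp only [State.tick_time] at ht₃
      unfold overhead
      omega
  · have hne : ¬ 𝒲.Nonempty := by
      rw [← hans]; intro h; simp [Term.eval, h0, h] at hb
    refine Tri.to_rTri (tri_skip fun κ => ⟨?_, ?_, ?_⟩)
    · simp only [State.tick_out, eo₂]
      simp [Finset.not_nonempty_iff_eq_empty.1 hne]
    · simp only [State.tick_calls]; omega
    · simp only [State.tick_time, overhead]; omega

theorem sum_descents_le {𝒲 : Finset (Finset ℕ)} {n k : ℕ}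
    (h𝒲 : 𝒲 ⊆ (Finset.range n).powersetCard k) :
    ∑ κ, descents 𝒲 n k κ ≤
      (if 𝒲.Nonempty ∧ k ≠ 0 ∧ 2 ≤ n then
        1 + 2 ^ k * ((k + 3) * width n * (𝒲.card * 8 ^ k)) else 0) *
        Fintype.card (Fin n → Fin (2 ^ ((k + 2) * width n))) := by
  by_cases h : 𝒲.Nonempty ∧ k ≠ 0 ∧ 2 ≤ n
  · simp only [descents, if_pos h]
    exact sum_card_frontier_le h.2.1 h𝒲 h.1 (Nat.lt_pow_succ_log_self (by norm_num) _).le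
  · simp [descents, if_neg h]

/-- Over a uniform finite space an expectation bound is a counting inequality multiplied by the size
of the space; the combinatorics can stay in ℕ. -/
theorem expect_uniform_le {Ω : Type} [Fintype Ω] [Nonempty Ω] {F : Ω → State} {f : State → ℕ}
    {X : Ω → ℕ} {a c Z : ℕ} (hf : ∀ ω, f (F ω) ≤ a + X ω * c)
    (hX : ∑ ω, X ω ≤ Z * Fintype.card Ω) :
    expect ((PMF.uniformOfFintype Ω).map F) f ≤ ((a + Z * c : ℕ) : ENNReal) := by
  classical
  have h₁ : expect ((PMF.uniformOfFintype Ω).map F) f =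
      ∑ ω, (Fintype.card Ω : ENNReal)⁻¹ * (f (F ω) : ENNReal) := by
    unfold expect
    simp only [PMF.map_apply, ← ENNReal.tsum_mul_right]
    rw [ENNReal.tsum_comm, tsum_fintype]
    refine Finset.sum_congr rfl fun ω _ => ?_
    rw [tsum_eq_single (F ω)]
    · simp
    · intro τ hτ
      simp [hτ]
  have hcard : (Fintype.card Ω : ENNReal) ≠ 0 := by simp
  rw [h₁, ← Finset.mul_sum, ← Nat.cast_sum, mul_comm, ← div_eq_mul_inv]
  refine ENNReal.div_le_of_le_mul ?_
  rw [← Nat.cast_mul, Nat.cast_le]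
  calc ∑ ω, f (F ω) ≤ ∑ ω, (a + X ω * c) := Finset.sum_le_sum fun ω _ => hf ω
    _ = Fintype.card Ω * a + (∑ ω, X ω) * c := by
        rw [Finset.sum_add_distrib, ← Finset.sum_mul]; simp
    _ ≤ Fintype.card Ω * a + (Z * Fintype.card Ω) * c := by gcongr
    _ = _ := by ring

/-- Correctness and expected cost of the algorithm, for any implementation of the oracle calls. -/
theorem enumAlg_spec {D : Option Prog} {T : ℕ} {𝒲 : Finset (Finset ℕ)}
    (hD : AskSpec I O D (ora 𝒲) T) (h𝒲 : 𝒲 ⊆ (Finset.range I.n).powersetCard I.k) :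
    ∃ μ, Enumerates I O (enumAlg D) 𝒲 μ ∧
      expect μ State.calls ≤ ((1 + (if 𝒲.Nonempty ∧ I.k ≠ 0 ∧ 2 ≤ I.n then
        1 + 2 ^ I.k * ((I.k + 3) * width I.n * (𝒲.card * 8 ^ I.k)) else 0) *
          ((I.k + 3) * width I.n + 1) : ℕ) : ENNReal) ∧
      expect μ State.time ≤ ((overhead I.n I.k T + (if 𝒲.Nonempty ∧ I.k ≠ 0 ∧ 2 ≤ I.n then
        1 + 2 ^ I.k * ((I.k + 3) * width I.n * (𝒲.card * 8 ^ I.k)) else 0) *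
          descentTime I.n I.k ((I.k + 3) * width I.n) T : ℕ) : ENNReal) := by
  obtain ⟨F, hE, hF⟩ := rTri_enumAlg hD h𝒲
  refine ⟨_, ⟨hE, fun τ hτ => ?_⟩, expect_uniform_le (fun ω => (hF ω).2.1) (sum_descents_le h𝒲),
    expect_uniform_le (fun ω => (hF ω).2.2) (sum_descents_le h𝒲)⟩
  obtain ⟨ω, -, rfl⟩ := (PMF.mem_support_map_iff _ _ _).1 hτ
  exact (hF ω).1

/-! ### Numerical bounds -/

/-- One factor `width n` counts heights, the other the calls of one descent. Since n ≥ 2, `width n`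
is at most twice the logarithm. The constants multiply to 4096^k = 2^(12k); the exponent 30 is the
one needed for the time. -/
theorem calls_bound {n k N : ℕ} (hk : k ≠ 0) (hn : 2 ≤ n) (hN : N ≠ 0) :
    (1 + 2 ^ k * ((k + 3) * width n * (N * 8 ^ k))) * ((k + 3) * width n + 1) ≤
      2 ^ (30 * k) * Nat.log 2 n ^ 2 * N := by
  have hl : 1 ≤ Nat.log 2 n := Nat.log_pos (by norm_num) hn
  have h4 : k + 3 ≤ 4 ^ k := by
    obtain ⟨j, rfl⟩ := Nat.exists_eq_succ_of_ne_zero hk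
    clear hk
    induction j with
    | zero => norm_num
    | succ j ih => rw [pow_succ]; omega
  set l := Nat.log 2 n
  set d := (k + 3) * width n with hd
  have hd1 : 1 ≤ d := by rw [hd]; exact Nat.mul_pos (by omega) (by simp [width])
  have hdl : d ≤ 4 ^ k * (2 * l) := by
    rw [hd]; exact Nat.mul_le_mul h4 (by simp only [width]; omega)
  have hN1 : 1 ≤ N := by omega
  have h16 : 16 ≤ 16 ^ k := Nat.le_self_pow hk 16
  have hone : 1 ≤ 2 ^ k * (d * (N * 8 ^ k)) := by
    have : 0 < 2 ^ k * (d * (N * 8 ^ k)) := by positivity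
    omega
  calc (1 + 2 ^ k * (d * (N * 8 ^ k))) * (d + 1)
      ≤ (2 * (2 ^ k * (d * (N * 8 ^ k)))) * (2 * d) := by gcongr <;> omega
    _ = 4 * (2 ^ k * 8 ^ k) * d ^ 2 * N := by ring
    _ ≤ 4 * (2 ^ k * 8 ^ k) * (4 ^ k * (2 * l)) ^ 2 * N := by gcongr
    _ = 16 * (2 ^ k * 8 ^ k * 4 ^ k * 4 ^ k) * l ^ 2 * N := by ring
    _ ≤ 16 ^ k * (2 ^ k * 8 ^ k * 4 ^ k * 4 ^ k) * l ^ 2 * N := by gcongr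
    _ = 4096 ^ k * l ^ 2 * N := by
        rw [← mul_pow, ← mul_pow, ← mul_pow, ← mul_pow]; norm_num
    _ ≤ (2 ^ 30) ^ k * l ^ 2 * N := by
        gcongr
        norm_num
    _ = _ := by rw [pow_mul]

/-- With w = 2^(k+1)(n+1) ≥ 2, every quantity is at most a power of w and every numeral is absorbed
by further powers. T ≥ 1 lets the steps outside the procedure be charged to T as well. -/
theorem time_bound {n k N T : ℕ} {p : Prop} [Decidable p] (hT : 1 ≤ T) :
    overhead n k T + (if p then 1 + 2 ^ k * ((k + 3) * width n * (N * 8 ^ k)) else 0) *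
        descentTime n k ((k + 3) * width n) T ≤
      (2 ^ (k + 1) * (n + 1)) ^ 30 * T * max N 1 := by
  have hif : (if p then 1 + 2 ^ k * ((k + 3) * width n * (N * 8 ^ k)) else 0) ≤
      1 + 2 ^ k * ((k + 3) * width n * (N * 8 ^ k)) := by split <;> omega
  refine (Nat.add_le_add_left (Nat.mul_le_mul_right _ hif) _).trans ?_
  set w := 2 ^ (k + 1) * (n + 1) with hw
  set M := max N 1
  have hM : 1 ≤ M := le_max_right _ _
  have hNM : N ≤ M := le_max_left _ _
  have h2k : 2 ≤ 2 ^ (k + 1) := two_le_two_pow (by omega)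
  have hn : n + 1 ≤ w := by rw [hw]; exact Nat.le_mul_of_pos_left _ (by omega)
  have hkw : 2 ^ (k + 1) ≤ w := by rw [hw]; exact Nat.le_mul_of_pos_right _ (by omega)
  have hw2 : 2 ≤ w := h2k.trans hkw
  have hk' : k + 1 < 2 ^ (k + 1) := Nat.lt_two_pow_self
  have hk : k + 3 ≤ w ^ 2 := by nlinarith
  have hk2 : 2 ^ k ≤ w := (Nat.pow_le_pow_right (by norm_num) (by omega)).trans hkw
  have h8 : 8 ^ k ≤ w ^ 3 := by
    calc 8 ^ k = (2 ^ k) ^ 3 := by rw [← pow_mul, mul_comm, pow_mul]; norm_num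
      _ ≤ w ^ 3 := Nat.pow_le_pow_left hk2 3
  have hb : width n ≤ w := by
    have := Nat.log_le_self 2 n
    simp only [width]; omega
  have hd : (k + 3) * width n ≤ w ^ 3 := by
    calc _ ≤ w ^ 2 * w := Nat.mul_le_mul hk hb
      _ = w ^ 3 := by ring
  have hL : (k + 2) * width n ≤ w ^ 3 := (Nat.mul_le_mul_right _ (by omega)).trans hd
  have pw : ∀ a e, a ≤ 2 ^ e → a ≤ w ^ e := fun a e h => h.trans (Nat.pow_le_pow_left hw2 e)
  have up : ∀ i j, i ≤ j → w ^ i ≤ w ^ j := fun i j h => Nat.pow_le_pow_right (by omega) h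
  have hw1 : w = w ^ 1 := (pow_one w).symm
  generalize (k + 3) * width n = d at *
  have hover : overhead n k T ≤ w ^ 12 * T := by
    have e1 : n ≤ w ^ 5 := by have := up 1 5 (by norm_num); omega
    have e2 : (k + 3) ^ 2 * width n ≤ w ^ 5 := by
      calc _ ≤ (w ^ 2) ^ 2 * w := Nat.mul_le_mul (Nat.pow_le_pow_left hk 2) hb
        _ = w ^ 5 := by ring
    have e3 : n * ((k + 2) * width n * 4 + width n * 3 + 8) ≤ 15 * w ^ 5 := by
      have a1 := up 1 3 (by norm_num)
      have a0 : 1 ≤ w ^ 3 := Nat.one_le_pow _ _ (by omega)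
      have a4 := up 4 5 (by norm_num)
      calc _ ≤ w * (15 * w ^ 3) := Nat.mul_le_mul (by omega) (by omega)
        _ = 15 * w ^ 4 := by ring
        _ ≤ _ := by omega
    have e4 : 1 ≤ w ^ 5 := Nat.one_le_pow _ _ (by omega)
    have e5 : overhead n k T ≤ 60 * w ^ 5 + T := by
      unfold overhead
      rw [mul_assoc 20]
      omega
    have e6 : w ^ 5 ≤ w ^ 5 * T := Nat.le_mul_of_pos_right _ hT
    have e7 : T ≤ w ^ 5 * T := Nat.le_mul_of_pos_left _ (by positivity)
    calc _ ≤ 61 * (w ^ 5 * T) := by omega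
      _ ≤ w ^ 6 * (w ^ 5 * T) := Nat.mul_le_mul_right _ (pw 61 6 (by norm_num))
      _ = w ^ 11 * T := by ring
      _ ≤ w ^ 12 * T := Nat.mul_le_mul_right _ (up 11 12 (by norm_num))
  have hnode : nodeTime n k d T + n + 10 ≤ w ^ 11 * T := by
    have a1 := up 1 3 (by norm_num)
    have a0 : 1 ≤ w ^ 3 := Nat.one_le_pow _ _ (by omega)
    have e1 : k * (d * 5 + n * 5 + 10 + 2) ≤ 22 * w ^ 5 := by
      calc _ ≤ w ^ 2 * (22 * w ^ 3) := Nat.mul_le_mul (by omega) (by omega)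
        _ = _ := by ring
    have a5 := up 1 5 (by norm_num)
    have a6 : 1 ≤ w ^ 5 := Nat.one_le_pow _ _ (by omega)
    have e2 : nodeTime n k d T + n + 10 ≤ 51 * w ^ 5 + T := by
      unfold nodeTime; omega
    have e6 : w ^ 5 ≤ w ^ 5 * T := Nat.le_mul_of_pos_right _ hT
    have e7 : T ≤ w ^ 5 * T := Nat.le_mul_of_pos_left _ (by positivity)
    calc _ ≤ 52 * (w ^ 5 * T) := by omega
      _ ≤ w ^ 6 * (w ^ 5 * T) := Nat.mul_le_mul_right _ (pw 52 6 (by norm_num))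
      _ = w ^ 11 * T := by ring
  have hdesc : descentTime n k d T ≤ w ^ 18 * T := by
    have a0 : 1 ≤ w ^ 3 := Nat.one_le_pow _ _ (by omega)
    have a14 : 1 ≤ w ^ 14 * T := Nat.mul_pos (by positivity) hT
    calc descentTime n k d T ≤ (2 * w ^ 3) * (w ^ 11 * T) + 10 := by
          unfold descentTime
          exact Nat.add_le_add_right (Nat.mul_le_mul (by omega) hnode) _
      _ = 2 * (w ^ 14 * T) + 10 := by ring
      _ ≤ 12 * (w ^ 14 * T) := by omega
      _ ≤ w ^ 4 * (w ^ 14 * T) := Nat.mul_le_mul_right _ (pw 12 4 (by norm_num))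
      _ = w ^ 18 * T := by ring
  have hZ : 1 + 2 ^ k * (d * (N * 8 ^ k)) ≤ w ^ 8 * M := by
    have a1 : 1 ≤ w ^ 7 * M := Nat.mul_pos (by positivity) hM
    calc _ ≤ 1 + w * (w ^ 3 * (M * w ^ 3)) := by gcongr
      _ = 1 + w ^ 7 * M := by ring
      _ ≤ 2 * (w ^ 7 * M) := by omega
      _ ≤ w * (w ^ 7 * M) := Nat.mul_le_mul_right _ hw2
      _ = w ^ 8 * M := by ring
  calc _ ≤ w ^ 12 * T + (w ^ 8 * M) * (w ^ 18 * T) := Nat.add_le_add hover (Nat.mul_le_mul hZ hdesc)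
    _ ≤ w ^ 26 * T * M + w ^ 26 * T * M := by
        refine Nat.add_le_add ?_ (le_of_eq (by ring))
        calc w ^ 12 * T ≤ w ^ 26 * T := Nat.mul_le_mul_right _ (up 12 26 (by norm_num))
          _ ≤ _ := Nat.le_mul_of_pos_right _ hM
    _ = 2 * (w ^ 26 * T * M) := by ring
    _ ≤ w ^ 4 * (w ^ 26 * T * M) := Nat.mul_le_mul_right _ (pw 2 4 (by norm_num))
    _ = _ := by ring

/-! ### The theorem -/

theorem Problem.witnesses_subset (Q : Problem) (I : Instance) :
    Q.witnesses I ⊆ (Finset.range I.n).powersetCard I.k := by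
  classical exact Finset.filter_subset _ _

/-- Every program takes a step, so a valid time bound cannot be 0 and the product bound on the total
time cannot collapse. -/
theorem DecidesWithin.pos {𝒲 : Finset (Finset ℕ)} {D : Prog} {X : Finset ℕ} {t : ℕ}
    (h : DecidesWithin I 𝒲 D X t) : 1 ≤ t := by
  obtain ⟨τ, h₁, -, h₃⟩ := h
  have := h₁.time_lt τ (by simp)
  omega

/-- The algorithm without an oracle, if the procedure `D` answers each oracle call in time `T`. -/
theorem enumAlg_linked {Q : Problem} {D : Prog} {T : ℕ}
    (h : ∀ X ⊆ Finset.range I.n, DecidesWithin I (Q.witnesses I) D X T) :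
    ∃ μ, Enumerates I none ((enumAlg none).link D) (Q.witnesses I) μ ∧
      expect μ State.time ≤ (((2 ^ (I.k + 1) * (I.n + 1)) ^ 30 * T *
        max (Q.witnesses I).card 1 : ℕ) : ENNReal) := by
  obtain ⟨μ, h₁, -, h₂⟩ := enumAlg_spec (askSpec_call h) (Q.witnesses_subset I)
  rw [link_enumAlg]
  exact ⟨μ, h₁, h₂.trans (Nat.cast_le.2 (time_bound (h ∅ (Finset.empty_subset _)).pos))⟩

theorem primrec_two_pow (c : ℕ) : Primrec fun k : ℕ => 2 ^ (c * (k + 1)) := by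
  have h : Primrec fun m : ℕ => 2 ^ m := by
    refine (Primrec.nat_rec₁ (α := ℕ) 1
      (f := fun _ r => 2 * r) (Primrec.nat_mul.comp (Primrec.const 2) Primrec.snd)).of_eq fun m => ?_
    induction m with
    | zero => rfl
    | succ m ih => simp only [pow_succ] at *; rw [ih]; ring
  exact h.comp (Primrec.nat_mul.comp (Primrec.const c) Primrec.succ)

end WitnessEnum

theorem mainTheorem1 :
    (∃ (P : Prog) (c : ℕ),
      -- correctness, and the expected number of oracle calls
      (∀ (Q : Problem), ∀ I ∈ Q.instances,
        ∃ μ, Enumerates I (some (ora (Q.witnesses I))) P (Q.witnesses I) μ ∧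
          expect μ State.calls ≤ ENNReal.ofReal
            (1 + 2 ^ (c * I.k) * (Real.logb 2 I.n) ^ 2 * (Q.witnesses I).card)) ∧
      -- the expected total time of the same algorithm, once oracle calls are executed by `D`
      (∀ (Q : Problem) (D : Prog) (g : ℕ → ℕ) (d : ℕ),
        (∀ I ∈ Q.instances, ∀ X ⊆ Finset.range I.n,
          DecidesWithin I (Q.witnesses I) D X (g I.k * (I.n + 1) ^ d)) →
        ∀ I ∈ Q.instances,
          ∃ μ, Enumerates I none (P.link D) (Q.witnesses I) μ ∧
            expect μ State.time ≤
              ((2 ^ (c * (I.k + 1)) * g I.k * (I.n + 1) ^ (d + c) *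
                max (Q.witnesses I).card 1 : ℕ) : ENNReal))) ∧
    -- fixed-parameter tractable decision gives expected-output-fpt enumeration
    (∀ Q : Problem, Q.DecisionFPT → Q.ExpectedOutputFPT) := by
  refine ⟨⟨enumAlg none, 30, ?_, ?_⟩, ?_⟩
  · intro Q I _
    obtain ⟨μ, h₁, h₂, -⟩ := enumAlg_spec (askSpec_query I (ora (Q.witnesses I)))
      (Q.witnesses_subset I)
    refine ⟨μ, h₁, h₂.trans ?_⟩
    rw [← ENNReal.ofReal_natCast]
    refine ENNReal.ofReal_le_ofReal ?_
    rw [Nat.cast_add, Nat.cast_one]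
    refine add_le_add_right ?_ _
    split_ifs with h
    · obtain ⟨h₀, hk, hn⟩ := h
      have hlog : (Nat.log 2 I.n : ℝ) ≤ Real.logb 2 I.n := by
        exact_mod_cast Real.natLog_le_logb I.n 2
      calc _ ≤ ((2 ^ (30 * I.k) * Nat.log 2 I.n ^ 2 * (Q.witnesses I).card : ℕ) : ℝ) :=
            Nat.cast_le.2 (calls_bound hk hn (by simpa using h₀.ne_empty))
        _ ≤ _ := by
            push_cast
            gcongr
    -- If N = 0, k = 0 or n < 2, only the initial call is made, and it is paid for by the summand 1.
    · rw [zero_mul, Nat.cast_zero]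
      positivity
  · intro Q D g d h I hI
    obtain ⟨μ, h₁, h₂⟩ := enumAlg_linked (h I hI)
    refine ⟨μ, h₁, h₂.trans (Nat.cast_le.2 (le_of_eq ?_))⟩
    rw [mul_pow, ← pow_mul, pow_add, mul_comm (I.k + 1)]
    generalize I.n + 1 = x
    ring
  · rintro Q ⟨D, g, d, hg, h⟩
    -- In the exponent, 30 comes from the power of n + 1, d from the procedure, and 1 from the
    -- factor max(N, 1); all three bases are at most size + N + 1, because the size includes n.
    refine ⟨(enumAlg none).link D, fun k => 2 ^ (30 * (k + 1)) * g k, 30 + d + 1, ?_, ?_⟩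
    · exact Primrec.nat_mul.to_comp.comp (primrec_two_pow 30).to_comp hg
    · intro I hI
      obtain ⟨μ, h₁, h₂⟩ := enumAlg_linked (h I hI)
      refine ⟨μ, h₁, h₂.trans (Nat.cast_le.2 ?_)⟩
      set N := (Q.witnesses I).card
      have hn : I.n + 1 ≤ I.size + N + 1 := by simp only [Instance.size]; omega
      calc (2 ^ (I.k + 1) * (I.n + 1)) ^ 30 * (g I.k * (I.size + 1) ^ d) * max N 1
          ≤ (2 ^ (I.k + 1) * (I.size + N + 1)) ^ 30 * (g I.k * (I.size + N + 1) ^ d) *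
            (I.size + N + 1) := by
            gcongr
            · omega
            · exact max_le (by omega) (by omega)
        _ = _ := by
            rw [mul_pow, ← pow_mul, mul_comm (I.k + 1), pow_succ _ (30 + d), pow_add]
            generalize I.size + N + 1 = x
            ring
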